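/- Let $p\ge 1$ and let $G=(V,E)$ be a graph on $V=\{1,\dots,p\}$. For $\lambda>0$ the ferromagnetic Ising model on $G$ is the distribution $P_G(x)=\frac1Z\exp\big(\lambda\sum_{\{i,j\}\in E}x_ix_j\big)$ on $\{-1,1\}^p$. Given $n$ independent samples from $P_G$, a decoder outputs a graph on $V$ with edge set $\hat E$. For a class $\mathcal G$ of graphs put $P_{\mathrm e}(q):=\max_{G\in\mathcal G}\mathbb P_G[\,|E\,\Delta\,\hat E|>q\,]$. Let $\mathcal G_{k,d,\eta,\gamma}$ be the class of graphs on $V$ with at most $k$ edges and all degrees at most $d$ such that, for any two distinct non-adjacent vertices $u,v$, there is a set of at most $\eta$ vertices other than $u,v$ that meets every path of length at most $\gamma$ between $u$ and $v$. Let $H_2(\theta)=-\theta\log\theta-(1-\theta)\log(1-\theta)$ (natural logarithms). Theorem. Let $\theta\in(0,\frac12)$. Let $p,k,d,\eta,\gamma,m$ be integers with $0\le k\le p/4$, $1\le\eta\le\lfloor d/2\rfloor$, $\gamma\ge1$ and $0\le m\le\lfloor d/2\rfloor-\eta$, let $c\in(1/\eta,1]$ and $\lambda>0$, and put $$q_{\max}=\Big\lfloor\theta\,\frac{(c\eta-1)^2k}{2c\eta\,(2\eta+m(\gamma+1))}\Big\rfloor,\qquad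 N=\Big\lfloor\frac{k}{c\eta\,\big(c\eta/2+2(1-c)\eta+m(\gamma+1)\big)}\Big\rfloor\binom{\lceil c\eta\rceil}{2}.$$ If some decoder using $n$ samples achieves $P_{\mathrm e}(q_{\max})\le\delta$ over $\mathcal G_{k,d,\eta,\gamma}$, then $$n\ \ge\ \max\bigg\{\frac{1+\cosh(2\lambda)^{(1-c)\eta-1}\Big(\frac{1+(\tanh\lambda)^{\gamma+1}}{1-(\tanh\lambda)^{\gamma+1}}\Big)^{m}}{2\lambda c\eta}\,\big(\log2-H_2(\theta)\big),\ \frac{2(k-q_{\max})\log p}{k\,\lambda\tanh\lambda}\bigg\}\,\big(1-\delta-o(1)\big),$$ where $o(1)$ is a quantity depending only on $\theta$ and $N$ that tends to $0$ as $N\to\infty$ with $\theta$ fixed. In particular the bound is uniform in all the other parameters, which may vary arbitrarily with $p$. -/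

import Mathlib

open Filter Topology

noncomputable section

namespace Ising

/-- A configuration of `p` spins, each in `{-1, 1}` (the units of `ℤ`). -/
abbrev Config (p : ℕ) : Type := Fin p → ℤˣ

/-- The energy `∑ λ_{ij} x_i x_j` over unordered pairs, with `λ_{ij} = lam` on the edges of `G` and
`0` elsewhere. -/
def energy {p : ℕ} (lam : ℝ) (G : SimpleGraph (Fin p)) (x : Config p) : ℝ :=
  open Classical in
  ∑ i : Fin p, ∑ j ∈ Finset.Ioi i,
    (if G.Adj i j then lam else 0) * (((x i : ℤ) : ℝ) * ((x j : ℤ) : ℝ))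

/-- The partition function. -/
def partitionFn {p : ℕ} (lam : ℝ) (G : SimpleGraph (Fin p)) : ℝ :=
  ∑ x : Config p, Real.exp (energy lam G x)

/-- The probability mass function `P_G` of the ferromagnetic Ising model on `G`. -/
def prob {p : ℕ} (lam : ℝ) (G : SimpleGraph (Fin p)) (x : Config p) : ℝ :=
  Real.exp (energy lam G x) / partitionFn lam G

/-- The probability, under `n` independent samples from `P_G` (one per row), that the sample matrix
lies in `A`. -/
def sampleProb {p : ℕ} (lam : ℝ) (G : SimpleGraph (Fin p)) (n : ℕ)
    (A : Set (Fin n → Config p)) : ℝ :=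
  open Classical in
  ∑ X : Fin n → Config p, if X ∈ A then ∏ t : Fin n, prob lam G (X t) else 0

/-- The edit distance `|E Δ E'|` between two graphs on the same vertices. -/
def editDist {p : ℕ} (G H : SimpleGraph (Fin p)) : ℕ :=
  (symmDiff G.edgeSet H.edgeSet).ncard

/-- `(η, γ)`-separation: for any two distinct non-adjacent vertices, at most `η` other vertices
suffice to block all paths of length at most `γ` between them. -/
def Separated {V : Type*} (η γ : ℕ) (G : SimpleGraph V) : Prop :=
  ∀ u v : V, u ≠ v → ¬ G.Adj u v →
    ∃ S : Finset V, S.card ≤ η ∧ u ∉ S ∧ v ∉ S ∧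
      ∀ w : G.Walk u v, w.IsPath → w.length ≤ γ → ∃ s ∈ S, s ∈ w.support

/-- The sparse separator class: at most `k` edges, all degrees at most `d`, `(η, γ)`-separated. -/
def sparseSeparatorClass (p k d η γ : ℕ) : Set (SimpleGraph (Fin p)) :=
  {G | G.edgeSet.ncard ≤ k ∧ (∀ v, (G.neighborSet v).ncard ≤ d) ∧ Separated η γ G}

/-- The worst-case error probability over the class `𝒢` of a decoder that is allowed up to `qmax`
edge errors. -/
def errorProb {p n : ℕ} (lam : ℝ) (𝒢 : Set (SimpleGraph (Fin p)))
    (decoder : (Fin n → Config p) → SimpleGraph (Fin p)) (qmax : ℕ) : ℝ :=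
  ⨆ G : 𝒢, sampleProb lam (G : SimpleGraph (Fin p)) n
    {X | qmax < editDist (G : SimpleGraph (Fin p)) (decoder X)}

/-- The distortion level `⌊θ (cη - 1)² k / (2cη (2η + m(γ+1)))⌋`. -/
def distortion (θ c : ℝ) (k η γ m : ℕ) : ℕ :=
  ⌊θ * ((c * η - 1) ^ 2 * k / (2 * c * η * (2 * η + m * (γ + 1))))⌋₊

/-- The size parameter `⌊k / (cη (cη/2 + 2(1-c)η + m(γ+1)))⌋ * (⌈cη⌉ choose 2)` that governs the
asymptotics. -/
def sizeParam (c : ℝ) (k η γ m : ℕ) : ℕ :=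
  ⌊(k : ℝ) / (c * η * (c * η / 2 + 2 * (1 - c) * η + m * (γ + 1)))⌋₊ * ⌈c * η⌉₊.choose 2

end Ising

end

/-!
Two families of graphs in the class are fed to Fano's inequality with approximate recovery
(`Ising.fano`); each gives one of the two terms in the maximum.

*First term.* A family is described by a `Layout`: cores, links, and toggles. A link joins two cores
by `b = η - ⌈c η⌉` paths of length `2` and `m` paths of length `γ + 1`, present in every graph, and
each of `M` edges between cores is on or off independently. Summing out the inner spins of a path of
length `l` leaves an edge of strength `(tanh λ) ^ l` between its ends, so the paths of a link give
odds `R = cosh (2 λ) ^ b * ((1 + (tanh λ) ^ (γ + 1)) / (1 - (tanh λ) ^ (γ + 1))) ^ m` for agreement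
of the two cores, and by Griffiths' inequality the rest of the graph can only raise them
(`disagreement_parallel_paths`). Hence two cores at link distance at most `c η` differ with
probability at most `c η / (1 + R)`, and the relative entropy to the graph with all toggles on is at
most `M * 2 λ c η / (1 + R)` (`Layout.relEntropy_le`). A Hamming ball of radius `θ M` holds at most
`exp (M H₂(θ))` of the `2 ^ M` graphs (`Layout.ball_le`). Two non-adjacent cores are separated by
the toggle neighbours of one of them and the midpoints of the short paths between them, because the
other paths are longer than `γ` (`Layout.exists_separator_core`).

For the bound to hold uniformly, `M` must reach the quantity whose multiple by `θ` is rounded down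
in the distortion level, without loss from rounding. This is achieved by a cyclic chain of
cores with toggles up to cyclic distance `⌊⌈c η⌉ / 2⌋` when the edge budget `k` allows enough cores,
and otherwise by one clique on `⌈c η⌉` cores linked along a path (`exists_toggle_family`). Disjoint
cliques would not suffice: when only a few of them fit, rounding their number down loses a
constant factor.

*Second term.* The family consists of the matchings that join each of the first `k` vertices to one
of the others. There are at least `(p / 2) ^ k` of them, at most `4 ^ k p ^ q` of them lie within
distance `q` of a given graph (`ball_matching_le`), and the relative entropy to the empty graph is
`k (λ tanh λ - log cosh λ) ≤ k λ tanh λ / 2` (`relEntropy_matching_le`).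
-/

namespace Ising

/-! ### Fano's inequality for approximate recovery -/

lemma partitionFn_pos {p : ℕ} (lam : ℝ) (G : SimpleGraph (Fin p)) : 0 < partitionFn lam G :=
  Finset.sum_pos (fun _ _ => Real.exp_pos _) Finset.univ_nonempty

lemma prob_pos {p : ℕ} (lam : ℝ) (G : SimpleGraph (Fin p)) (x : Config p) : 0 < prob lam G x :=
  div_pos (Real.exp_pos _) (partitionFn_pos lam G)

lemma sum_prob {p : ℕ} (lam : ℝ) (G : SimpleGraph (Fin p)) : ∑ x, prob lam G x = 1 := by
  unfold prob
  rw [← Finset.sum_div]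
  exact div_self (partitionFn_pos lam G).ne'

/-- The relative entropy `D(P_G ‖ P_H)` of two Ising models with the same edge strength. -/
noncomputable def relEntropy {p : ℕ} (lam : ℝ) (G H : SimpleGraph (Fin p)) : ℝ :=
  ∑ x, prob lam G x * Real.log (prob lam G x / prob lam H x)

lemma sum_prod_mul_apply {α : Type*} [Fintype α] {n : ℕ} (w f : α → ℝ)
    (hw : ∑ x, w x = 1) (i : Fin n) :
    ∑ Y : Fin n → α, (∏ j, w (Y j)) * f (Y i) = ∑ x, w x * f x := by
  classical
  have h := Finset.prod_univ_sum (fun _ : Fin n => (Finset.univ : Finset α))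
    (fun j x => w x * if j = i then f x else 1)
  rw [Fintype.piFinset_univ] at h
  have e1 : ∀ Y : Fin n → α, ∏ j, (w (Y j) * if j = i then f (Y j) else 1)
      = (∏ j, w (Y j)) * f (Y i) := by
    intro Y
    rw [Finset.prod_mul_distrib, Finset.prod_ite_eq' Finset.univ i (fun j => f (Y j))]
    simp
  have e2 : ∀ j : Fin n, ∑ x, (w x * if j = i then f x else 1)
      = if j = i then ∑ x, w x * f x else 1 := by
    intro j
    split_ifs
    · rfl
    · simpa using hw
  simp only [e1, e2] at h
  rw [← h, Finset.prod_ite_eq' Finset.univ i (fun _ => ∑ x, w x * f x)]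
  simp

lemma sum_prod_apply {α : Type*} [Fintype α] (n : ℕ) (w : α → ℝ) (hw : ∑ x, w x = 1) :
    ∑ Y : Fin n → α, ∏ j, w (Y j) = 1 := by
  classical
  have h := Finset.prod_univ_sum (fun _ : Fin n => (Finset.univ : Finset α)) (fun _ x => w x)
  rw [Fintype.piFinset_univ] at h
  rw [← h]
  simp [hw]

/-- Relative entropy is additive over independent samples. -/
lemma sum_prod_log_div {p : ℕ} (lam : ℝ) (G H : SimpleGraph (Fin p)) (n : ℕ) :
    ∑ Y : Fin n → Config p, (∏ j, prob lam G (Y j)) *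
      Real.log ((∏ j, prob lam G (Y j)) / ∏ j, prob lam H (Y j)) = n * relEntropy lam G H := by
  have e1 : ∀ Y : Fin n → Config p, (∏ j, prob lam G (Y j)) *
      Real.log ((∏ j, prob lam G (Y j)) / ∏ j, prob lam H (Y j)) =
      ∑ i, (∏ j, prob lam G (Y j)) * Real.log (prob lam G (Y i) / prob lam H (Y i)) := by
    intro Y
    rw [← Finset.prod_div_distrib, Real.log_prod, Finset.mul_sum]
    intro i _
    exact (div_pos (prob_pos _ _ _) (prob_pos _ _ _)).ne'
  simp only [e1]
  rw [Finset.sum_comm]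
  have e2 : ∀ i : Fin n, ∑ Y : Fin n → Config p, (∏ j, prob lam G (Y j)) *
      Real.log (prob lam G (Y i) / prob lam H (Y i)) = relEntropy lam G H := fun i =>
    sum_prod_mul_apply (prob lam G) (fun x => Real.log (prob lam G x / prob lam H x))
      (sum_prob lam G) i
  simp [e2]

lemma one_sub_le_sum_success {p n : ℕ} {lam δ : ℝ} {𝒢 : Set (SimpleGraph (Fin p))}
    {decoder : (Fin n → Config p) → SimpleGraph (Fin p)} {q : ℕ}
    (herr : errorProb lam 𝒢 decoder q ≤ δ) {G : SimpleGraph (Fin p)} (hG : G ∈ 𝒢) :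
    1 - δ ≤ ∑ Y : Fin n → Config p, (∏ j, prob lam G (Y j)) *
      (if editDist G (decoder Y) ≤ q then 1 else 0) := by
  classical
  have h1 : sampleProb lam G n {X | q < editDist G (decoder X)} ≤ δ := by
    refine le_trans ?_ herr
    unfold errorProb
    exact le_ciSup (f := fun G : 𝒢 => sampleProb lam (G : SimpleGraph (Fin p)) n
      {X | q < editDist (G : SimpleGraph (Fin p)) (decoder X)})
      (Set.finite_range _).bddAbove ⟨G, hG⟩
  have h2 : sampleProb lam G n {X | q < editDist G (decoder X)} +
      ∑ Y : Fin n → Config p, (∏ j, prob lam G (Y j)) *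
        (if editDist G (decoder Y) ≤ q then 1 else 0) = 1 := by
    refine Eq.trans ?_ (sum_prod_apply n (prob lam G) (sum_prob lam G))
    unfold sampleProb
    rw [← Finset.sum_add_distrib]
    refine Finset.sum_congr rfl fun Y _ => ?_
    by_cases h : editDist G (decoder Y) ≤ q
    · simp [h]
    · simp [h, not_le.mp h]
  linarith

lemma errorProb_nonneg {p n : ℕ} (lam : ℝ) (𝒢 : Set (SimpleGraph (Fin p)))
    (decoder : (Fin n → Config p) → SimpleGraph (Fin p)) (q : ℕ) :
    0 ≤ errorProb lam 𝒢 decoder q := by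
  refine Real.iSup_nonneg fun G => Finset.sum_nonneg fun X _ => ?_
  split_ifs
  · exact Finset.prod_nonneg fun _ _ => (prob_pos _ _ _).le
  · exact le_rfl

/-- **Fano's inequality with approximate recovery.** A finite family of graphs in the class of
which any ball of radius `q` contains at most the fraction `exp (-Λ)`, and whose relative entropies
to one reference model are at most `D`, forces `(1 - δ) Λ - log 2 ≤ n D`. The proof applies
`log z ≤ z - 1` to `z = e^{Λ 1_{success}} Q / (2 P)` and averages over the family. -/
theorem fano {p n : ℕ} {ι : Type*} [Fintype ι] [Nonempty ι] {lam δ : ℝ}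
    {𝒢 : Set (SimpleGraph (Fin p))}
    {decoder : (Fin n → Config p) → SimpleGraph (Fin p)} {q : ℕ}
    (herr : errorProb lam 𝒢 decoder q ≤ δ)
    (G : ι → SimpleGraph (Fin p)) (hG : ∀ t, G t ∈ 𝒢) (G₀ : SimpleGraph (Fin p)) {D Λ : ℝ}
    (hD : ∀ t, relEntropy lam (G t) G₀ ≤ D) (hΛ : 0 ≤ Λ)
    (hball : ∀ H : SimpleGraph (Fin p),
      (∑ t, if editDist (G t) H ≤ q then (1 : ℝ) else 0) * Real.exp Λ ≤ Fintype.card ι) :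
    (1 - δ) * Λ - Real.log 2 ≤ n * D := by
  classical
  set P : ι → (Fin n → Config p) → ℝ := fun t Y => ∏ j, prob lam (G t) (Y j) with hP
  set Q : (Fin n → Config p) → ℝ := fun Y => ∏ j, prob lam G₀ (Y j) with hQ
  set s : ι → (Fin n → Config p) → ℝ :=
    fun t Y => if editDist (G t) (decoder Y) ≤ q then 1 else 0 with hs
  have hPpos : ∀ t Y, 0 < P t Y := fun t Y => Finset.prod_pos fun _ _ => prob_pos _ _ _
  have hQpos : ∀ Y, 0 < Q Y := fun Y => Finset.prod_pos fun _ _ => prob_pos _ _ _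
  have key : ∀ t, (1 - δ) * Λ - n * D - Real.log 2 ≤
      (∑ Y, Q Y * Real.exp (Λ * s t Y)) / 2 - 1 := by
    intro t
    have h1 : ∀ Y, P t Y * (Λ * s t Y - Real.log (P t Y / Q Y) - Real.log 2) ≤
        Q Y * Real.exp (Λ * s t Y) / 2 - P t Y := by
      intro Y
      have hp := hPpos t Y
      have hq := hQpos Y
      have hz : 0 < Real.exp (Λ * s t Y) * Q Y / (2 * P t Y) := by positivity
      have hlog := Real.log_le_sub_one_of_pos hz
      rw [Real.log_div (by positivity) (by positivity),
        Real.log_mul (by positivity) (by positivity), Real.log_exp,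
        Real.log_mul (by positivity) (by positivity)] at hlog
      rw [Real.log_div hp.ne' hq.ne']
      have := mul_le_mul_of_nonneg_left hlog hp.le
      have e : P t Y * (Real.exp (Λ * s t Y) * Q Y / (2 * P t Y) - 1) =
          Q Y * Real.exp (Λ * s t Y) / 2 - P t Y := by
        field_simp
      linarith
    have h2 := Finset.sum_le_sum fun Y (_ : Y ∈ Finset.univ) => h1 Y
    have h3 : ∑ Y, P t Y = 1 := sum_prod_apply n (prob lam (G t)) (sum_prob lam (G t))
    have h4 : ∑ Y, P t Y * Real.log (P t Y / Q Y) = n * relEntropy lam (G t) G₀ :=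
      sum_prod_log_div lam (G t) G₀ n
    have h5 : 1 - δ ≤ ∑ Y, P t Y * s t Y := one_sub_le_sum_success herr (hG t)
    have h6 : ∑ Y, P t Y * (Λ * s t Y - Real.log (P t Y / Q Y) - Real.log 2) =
        Λ * (∑ Y, P t Y * s t Y) - ∑ Y, P t Y * Real.log (P t Y / Q Y)
          - Real.log 2 * ∑ Y, P t Y := by
      rw [Finset.mul_sum, Finset.mul_sum, ← Finset.sum_sub_distrib, ← Finset.sum_sub_distrib]
      exact Finset.sum_congr rfl fun Y _ => by ring
    rw [h6, h4, h3, Finset.sum_sub_distrib, h3, ← Finset.sum_div] at h2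
    have h7 := mul_le_mul_of_nonneg_left (hD t) (Nat.cast_nonneg (α := ℝ) n)
    have h8 := mul_le_mul_of_nonneg_left h5 hΛ
    linarith
  have hsum := Finset.sum_le_sum fun t (_ : t ∈ Finset.univ) => key t
  rw [Finset.sum_const, Finset.sum_sub_distrib, ← Finset.sum_div, Finset.sum_comm,
    Finset.sum_const, nsmul_eq_mul, nsmul_eq_mul, Finset.card_univ] at hsum
  have hQs : ∑ Y, Q Y = 1 := sum_prod_apply n (prob lam G₀) (sum_prob lam G₀)
  have hcard : (0 : ℝ) < Fintype.card ι := by exact_mod_cast Fintype.card_pos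
  have hY : ∀ Y, ∑ t, Q Y * Real.exp (Λ * s t Y) ≤ Q Y * (2 * Fintype.card ι) := by
    intro Y
    rw [← Finset.mul_sum]
    refine mul_le_mul_of_nonneg_left ?_ (hQpos Y).le
    have : ∀ t, Real.exp (Λ * s t Y) ≤ 1 + s t Y * Real.exp Λ := by
      intro t
      simp only [hs]
      split_ifs
      · simp
      · simp
    calc ∑ t, Real.exp (Λ * s t Y) ≤ ∑ t, (1 + s t Y * Real.exp Λ) :=
          Finset.sum_le_sum fun t _ => this t
      _ = Fintype.card ι + (∑ t, s t Y) * Real.exp Λ := by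
          rw [Finset.sum_add_distrib, Finset.sum_mul]; simp
      _ ≤ 2 * Fintype.card ι := by linarith [hball (decoder Y)]
  have hYs := Finset.sum_le_sum fun Y (_ : Y ∈ Finset.univ) => hY Y
  rw [← Finset.sum_mul, hQs] at hYs
  have : (Fintype.card ι : ℝ) * ((1 - δ) * Λ - n * D - Real.log 2) ≤ 0 := by linarith
  have := nonpos_of_mul_nonpos_right this hcard
  linarith

/-! ### High-temperature expansion and elimination of spins -/

/-- The spin `x i` as a real number. -/
def spin {V : Type*} (x : V → ℤˣ) (i : V) : ℝ := ((x i : ℤ) : ℝ)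

lemma spin_mul_self {V : Type*} (x : V → ℤˣ) (i : V) : spin x i * spin x i = 1 := by
  unfold spin
  rcases Int.units_eq_one_or (x i) with h | h <;> simp [h]

lemma spin_mul_spin_eq {V : Type*} (x : V → ℤˣ) (i j : V) :
    spin x i * spin x j = if x i = x j then 1 else -1 := by
  unfold spin
  rcases Int.units_eq_one_or (x i) with h | h <;> rcases Int.units_eq_one_or (x j) with h' | h' <;>
    simp [h, h']

/-- The product of the two spins at the ends of an edge. -/
def bond {V : Type*} (x : V → ℤˣ) (e : Sym2 V) : ℝ :=
  Sym2.lift ⟨fun i j => spin x i * spin x j, fun _ _ => mul_comm _ _⟩ e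

@[simp] lemma bond_mk {V : Type*} (x : V → ℤˣ) (i j : V) :
    bond x s(i, j) = spin x i * spin x j := rfl

lemma bond_eq_one_or {V : Type*} (x : V → ℤˣ) (e : Sym2 V) : bond x e = 1 ∨ bond x e = -1 := by
  induction e with | _ i j =>
  rw [bond_mk, spin_mul_spin_eq]
  split_ifs <;> simp

/-- The energy is `lam` times the sum of the bonds. -/
lemma energy_eq {p : ℕ} (lam : ℝ) (G : SimpleGraph (Fin p)) (E : Finset (Sym2 (Fin p)))
    (hE : G.edgeSet = ↑E) (x : Config p) : energy lam G x = lam * ∑ e ∈ E, bond x e := by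
  classical
  unfold energy
  have hmem : ∀ i j, G.Adj i j ↔ s(i, j) ∈ E := by
    intro i j
    rw [← SimpleGraph.mem_edgeSet, hE, Finset.mem_coe]
  rw [Finset.sum_sigma', Finset.mul_sum]
  simp only [ite_mul, zero_mul]
  rw [← Finset.sum_filter]
  refine Finset.sum_bij (fun a _ => s(a.1, a.2)) ?_ ?_ ?_ ?_
  · rintro ⟨i, j⟩ h
    simp only [Finset.mem_filter] at h
    exact (hmem i j).1 h.2
  · rintro ⟨i, j⟩ h ⟨i', j'⟩ h' heq
    simp only [Finset.mem_filter, Finset.mem_sigma, Finset.mem_Ioi, Finset.mem_univ,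
      true_and] at h h'
    rw [Sym2.eq_iff] at heq
    rcases heq with ⟨h1, h2⟩ | ⟨h1, h2⟩
    · simp only at h1 h2; subst h1 h2; rfl
    · simp only at h1 h2; subst h1 h2
      exact absurd (h.1.trans h'.1) (lt_irrefl _)
  · intro e he
    induction e with | _ i j =>
    have hadj : G.Adj i j := (hmem i j).2 he
    rcases lt_or_gt_of_ne hadj.ne with h | h
    · exact ⟨⟨i, j⟩, by simp [h, hadj], rfl⟩
    · exact ⟨⟨j, i⟩, by simp [h, hadj.symm], Sym2.eq_swap⟩
  · rintro ⟨i, j⟩ _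
    rfl

lemma tanh_pos {lam : ℝ} (h : 0 < lam) : 0 < Real.tanh lam := by
  rw [Real.tanh_eq_sinh_div_cosh]
  exact div_pos (Real.sinh_pos_iff.2 h) (Real.cosh_pos lam)

lemma exp_mul_bond {V : Type*} (lam : ℝ) (x : V → ℤˣ) (e : Sym2 V) :
    Real.exp (lam * bond x e) = Real.cosh lam * (1 + Real.tanh lam * bond x e) := by
  have hc := (Real.cosh_pos lam).ne'
  rw [Real.tanh_eq_sinh_div_cosh]
  rcases bond_eq_one_or x e with h | h <;> rw [h] <;> field_simp
  · linarith [Real.cosh_add_sinh lam]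
  · linarith [Real.cosh_sub_sinh lam]

/-- The normalised high-temperature weight `∏ (1 + t x_i x_j)` over the edges in `E`. -/
noncomputable def weight {V : Type*} (t : ℝ) (E : Finset (Sym2 V)) (x : V → ℤˣ) : ℝ :=
  ∏ e ∈ E, (1 + t * bond x e)

lemma exp_energy_eq {p : ℕ} (lam : ℝ) (G : SimpleGraph (Fin p)) (E : Finset (Sym2 (Fin p)))
    (hE : G.edgeSet = ↑E) (x : Config p) :
    Real.exp (energy lam G x) = Real.cosh lam ^ E.card * weight (Real.tanh lam) E x := by
  rw [energy_eq lam G E hE, Finset.mul_sum, Real.exp_sum, weight, ← Finset.prod_const,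
    ← Finset.prod_mul_distrib]
  exact Finset.prod_congr rfl fun e _ => exp_mul_bond lam x e

lemma partitionFn_eq {p : ℕ} (lam : ℝ) (G : SimpleGraph (Fin p)) (E : Finset (Sym2 (Fin p)))
    (hE : G.edgeSet = ↑E) :
    partitionFn lam G = Real.cosh lam ^ E.card * ∑ x : Config p, weight (Real.tanh lam) E x := by
  unfold partitionFn
  rw [Finset.mul_sum]
  exact Finset.sum_congr rfl fun x _ => exp_energy_eq lam G E hE x

lemma prob_eq {p : ℕ} (lam : ℝ) (G : SimpleGraph (Fin p)) (E : Finset (Sym2 (Fin p)))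
    (hE : G.edgeSet = ↑E) (x : Config p) :
    prob lam G x = weight (Real.tanh lam) E x / ∑ x : Config p, weight (Real.tanh lam) E x := by
  unfold prob
  rw [exp_energy_eq lam G E hE, partitionFn_eq lam G E hE,
    mul_div_mul_left _ _ (pow_pos (Real.cosh_pos lam) _).ne']

section Elimination

variable {V : Type*} [DecidableEq V]

/-- The function `g` does not depend on the spin at `y`. -/
def IndepOf (y : V) (g : (V → ℤˣ) → ℝ) : Prop := ∀ x s, g (Function.update x y s) = g x

lemma IndepOf.mul {y : V} {f g : (V → ℤˣ) → ℝ} (hf : IndepOf y f) (hg : IndepOf y g) :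
    IndepOf y (fun x => f x * g x) := fun x s => by simp only [hf x s, hg x s]

lemma IndepOf.add {y : V} {f g : (V → ℤˣ) → ℝ} (hf : IndepOf y f) (hg : IndepOf y g) :
    IndepOf y (fun x => f x + g x) := fun x s => by simp only [hf x s, hg x s]

lemma IndepOf.prod {κ : Type*} {y : V} (s : Finset κ) {f : κ → (V → ℤˣ) → ℝ}
    (hf : ∀ i ∈ s, IndepOf y (f i)) : IndepOf y (fun x => ∏ i ∈ s, f i x) := fun x u =>
  Finset.prod_congr rfl fun i hi => hf i hi x u

lemma indepOf_const {y : V} (c : ℝ) : IndepOf y (fun _ : V → ℤˣ => c) := fun _ _ => rfl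

lemma indepOf_spin {y i : V} (h : i ≠ y) : IndepOf y (fun x => spin x i) := fun x s => by
  simp [spin, Function.update_of_ne h]

lemma indepOf_bond {y : V} {e : Sym2 V} (h : y ∉ e) : IndepOf y (fun x => bond x e) := by
  induction e with | _ i j =>
  simp only [Sym2.mem_iff, not_or] at h
  exact (indepOf_spin (Ne.symm h.1)).mul (indepOf_spin (Ne.symm h.2))

lemma indepOf_weight {y : V} {t : ℝ} {E : Finset (Sym2 V)} (h : ∀ e ∈ E, y ∉ e) :
    IndepOf y (weight t E) :=
  IndepOf.prod E fun e he => (indepOf_const 1).add ((indepOf_const t).mul (indepOf_bond (h e he)))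

variable [Fintype V]

/-- A spin multiplied by a function independent of it sums to zero. -/
lemma sum_mul_spin_eq_zero {y : V} {g : (V → ℤˣ) → ℝ} (hg : IndepOf y g) :
    ∑ x, g x * spin x y = 0 := by
  have hinv : Function.Involutive (fun x : V → ℤˣ => Function.update x y (-x y)) := by
    intro x
    simp
  set σ : Equiv.Perm (V → ℤˣ) := hinv.toPerm _ with hσ
  have h := Equiv.sum_comp σ (fun x => g x * spin x y)
  have h' : ∀ x, g (σ x) * spin (σ x) y = -(g x * spin x y) := by
    intro x
    have e1 : g (σ x) = g x := hg x _
    have e2 : spin (σ x) y = -spin x y := by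
      simp [spin, hσ, Function.Involutive.toPerm]
    rw [e1, e2, mul_neg]
  simp only [h', Finset.sum_neg_distrib] at h
  linarith

/-- Series law: summing out `y` turns two consecutive edges into one of strength `s t`. -/
lemma sum_series {a y b : V} (ha : a ≠ y) (hb : b ≠ y) {g : (V → ℤˣ) → ℝ} (hg : IndepOf y g)
    (s t : ℝ) :
    ∑ x, g x * ((1 + s * (spin x a * spin x y)) * (1 + t * (spin x y * spin x b))) =
      ∑ x, g x * (1 + s * t * (spin x a * spin x b)) := by
  have h0 : ∑ x, (g x * (s * spin x a + t * spin x b)) * spin x y = 0 :=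
    sum_mul_spin_eq_zero (hg.mul (((indepOf_const s).mul (indepOf_spin ha)).add
      ((indepOf_const t).mul (indepOf_spin hb))))
  rw [← add_zero (∑ x, g x * (1 + s * t * (spin x a * spin x b))), ← h0, ← Finset.sum_add_distrib]
  refine Finset.sum_congr rfl fun x _ => ?_
  linear_combination (g x * s * t * spin x a * spin x b) * spin_mul_self x y

/-- Summing out the inner spins of a path of `l` edges from `v 0` to `v l` leaves one
edge of strength `t ^ l`. -/
lemma sum_path {t : ℝ} {l : ℕ} (hl : 1 ≤ l) (v : ℕ → V) {g : (V → ℤˣ) → ℝ}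
    (hg : ∀ j, 0 < j → j < l → IndepOf (v j) g)
    (hv : ∀ i j, i ≤ l → 0 < j → j < l → v i = v j → i = j) :
    ∑ x, g x * ∏ j ∈ Finset.range l, (1 + t * (spin x (v j) * spin x (v (j + 1)))) =
      ∑ x, g x * (1 + t ^ l * (spin x (v 0) * spin x (v l))) := by
  have key : ∀ k, k < l → ∑ x, g x * ∏ j ∈ Finset.range l,
      (1 + t * (spin x (v j) * spin x (v (j + 1)))) =
      ∑ x, (g x * ∏ j ∈ Finset.Ico (k + 1) l, (1 + t * (spin x (v j) * spin x (v (j + 1))))) *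
        (1 + t ^ (k + 1) * (spin x (v 0) * spin x (v (k + 1)))) := by
    intro k
    induction k with
    | zero =>
      intro _
      refine Finset.sum_congr rfl fun x _ => ?_
      rw [Finset.range_eq_Ico, Finset.prod_eq_prod_Ico_succ_bot (by omega)]
      ring
    | succ k ih =>
      intro hk
      rw [ih (by omega)]
      have hne : ∀ i, i ≤ l → i ≠ k + 1 → v i ≠ v (k + 1) := fun i hi hik h =>
        hik (hv i (k + 1) hi (by omega) hk h)
      have hind : IndepOf (v (k + 1)) (fun x => g x * ∏ j ∈ Finset.Ico (k + 1 + 1) l,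
          (1 + t * (spin x (v j) * spin x (v (j + 1))))) := by
        refine (hg (k + 1) (by omega) hk).mul (IndepOf.prod _ fun j hj => ?_)
        rw [Finset.mem_Ico] at hj
        exact (indepOf_const 1).add ((indepOf_const t).mul
          ((indepOf_spin (hne j (by omega) (by omega))).mul
            (indepOf_spin (hne (j + 1) (by omega) (by omega)))))
      have := sum_series (hne 0 (by omega) (by omega)) (hne (k + 2) (by omega) (by omega)) hind
        (t ^ (k + 1)) t
      rw [pow_succ t (k + 1), ← this]
      refine Finset.sum_congr rfl fun x _ => ?_
      rw [Finset.prod_eq_prod_Ico_succ_bot hk]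
      ring
  have := key (l - 1) (by omega)
  rw [this]
  have e : l - 1 + 1 = l := by omega
  simp [e]

/-- **Griffiths' first inequality** in the form needed here: with `t ≥ 0` the weighted sum of any
monomial in the spins is nonnegative. -/
lemma griffiths {t : ℝ} (ht : 0 ≤ t) (E : Finset (Sym2 V)) (a : V → ℕ) :
    0 ≤ ∑ x : V → ℤˣ, (∏ i, spin x i ^ a i) * weight t E x := by
  induction E using Finset.induction_on generalizing a with
  | empty =>
    simp only [weight, Finset.prod_empty, mul_one]
    have h := Finset.prod_univ_sum (fun _ : V => (Finset.univ : Finset ℤˣ))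
      (fun i s => (((s : ℤ) : ℝ)) ^ a i)
    rw [Fintype.piFinset_univ] at h
    simp only [spin]
    rw [← h]
    refine Finset.prod_nonneg fun i _ => ?_
    have : (Finset.univ : Finset ℤˣ) = {1, -1} := by decide
    rw [this, Finset.sum_pair (by decide)]
    rcases neg_one_pow_eq_or ℝ (a i) with h | h <;> simp [h]
  | insert e E he ih =>
    induction e with | _ u v =>
    have h1 := ih a
    have h2 := ih (fun i => a i + ((if i = u then 1 else 0) + (if i = v then 1 else 0)))
    have e1 : ∀ x : V → ℤˣ, (∏ i, spin x i ^ a i) * weight t (insert s(u, v) E) x =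
        (∏ i, spin x i ^ a i) * weight t E x + t * ((∏ i, spin x i ^
          (a i + ((if i = u then 1 else 0) + (if i = v then 1 else 0)))) * weight t E x) := by
      intro x
      have e2 : ∀ w : V, ∏ i, spin x i ^ (if i = w then 1 else 0) = spin x w := by
        intro w
        simp only [pow_ite, pow_one, pow_zero]
        rw [Finset.prod_ite_eq' Finset.univ w]
        simp
      simp only [pow_add, Finset.prod_mul_distrib, e2]
      rw [weight, Finset.prod_insert he, bond_mk, ← weight]
      ring
    simp only [e1]
    rw [Finset.sum_add_distrib, ← Finset.mul_sum]
    exact add_nonneg h1 (mul_nonneg ht h2)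

lemma sum_spin_mul_spin_mul_weight_nonneg {t : ℝ} (ht : 0 ≤ t) (E : Finset (Sym2 V)) (u v : V) :
    0 ≤ ∑ x : V → ℤˣ, (spin x u * spin x v) * weight t E x := by
  have h := griffiths ht E (fun i => (if i = u then 1 else 0) + (if i = v then 1 else 0))
  refine h.trans_eq (Finset.sum_congr rfl fun x _ => ?_)
  have e2 : ∀ w : V, ∏ i, spin x i ^ (if i = w then 1 else 0) = spin x w := by
    intro w
    simp only [pow_ite, pow_one, pow_zero]
    rw [Finset.prod_ite_eq' Finset.univ w]
    simp
  simp only [pow_add, Finset.prod_mul_distrib, e2]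

/-- The partition function of a ferromagnet is at least that of independent bonds. -/
lemma two_pow_le_sum_weight {t : ℝ} (ht : 0 ≤ t) (E : Finset (Sym2 V)) :
    (2 : ℝ) ^ Fintype.card V ≤ ∑ x : V → ℤˣ, weight t E x := by
  induction E using Finset.induction_on with
  | empty => simp [weight, Fintype.card_pi]
  | insert e E he ih =>
    induction e with | _ u v =>
    have e1 : ∀ x : V → ℤˣ, weight t (insert s(u, v) E) x =
        weight t E x + t * ((spin x u * spin x v) * weight t E x) := by
      intro x
      rw [weight, Finset.prod_insert he, bond_mk, ← weight]
      ring
    simp only [e1]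
    rw [Finset.sum_add_distrib, ← Finset.mul_sum]
    have := mul_nonneg ht (sum_spin_mul_spin_mul_weight_nonneg ht E u v)
    linarith

end Elimination

/-! ### Correlation across parallel paths -/

section Parallel

variable {V : Type*} [DecidableEq V] [Fintype V]

/-- The paths of a finite family share only their ends `u`, `v`: summing out the inner spins of all
of them, each path of length `l` becomes one edge of strength `t ^ l`. -/
lemma sum_parallel_paths {ρ : Type*} {t : ℝ} {u v : V} (len : ρ → ℕ) (pth : ρ → ℕ → V)
    (hlen : ∀ r, 1 ≤ len r) (h0 : ∀ r, pth r 0 = u) (h1 : ∀ r, pth r (len r) = v)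
    (hinj : ∀ r i r' j, i ≤ len r → 0 < j → j < len r' → pth r i = pth r' j → r = r' ∧ i = j)
    (s : Finset ρ) (g : (V → ℤˣ) → ℝ)
    (hg : ∀ r j, 0 < j → j < len r → IndepOf (pth r j) g) :
    ∑ x, g x * ∏ r ∈ s, ∏ j ∈ Finset.range (len r),
        (1 + t * (spin x (pth r j) * spin x (pth r (j + 1)))) =
      ∑ x, g x * ∏ r ∈ s, (1 + t ^ len r * (spin x u * spin x v)) := by
  classical
  induction s using Finset.induction_on generalizing g with
  | empty => simp
  | insert r s hr ih =>
    have hu : ∀ r' j, 0 < j → j < len r' → u ≠ pth r' j := fun r' j hj hj' h => by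
      have := (hinj r' 0 r' j (Nat.zero_le _) hj hj' ((h0 r').trans h)).2
      omega
    have hv : ∀ r' j, 0 < j → j < len r' → v ≠ pth r' j := fun r' j hj hj' h => by
      have := (hinj r' (len r') r' j le_rfl hj hj' ((h1 r').trans h)).2
      omega
    have e1 := sum_path (t := t) (hlen r) (pth r) (g := fun x => g x * ∏ r ∈ s,
        ∏ j ∈ Finset.range (len r), (1 + t * (spin x (pth r j) * spin x (pth r (j + 1)))))
      (fun j hj hj' => (hg r j hj hj').mul (IndepOf.prod _ fun r' hr' => IndepOf.prod _
        fun i hi => (indepOf_const 1).add ((indepOf_const t).mul ((indepOf_spin fun h => by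
            have := (hinj r' i r j (Finset.mem_range.1 hi).le hj hj' h).1
            exact hr (this ▸ hr')).mul (indepOf_spin fun h => by
            have := (hinj r' (i + 1) r j (Finset.mem_range.1 hi) hj hj' h).1
            exact hr (this ▸ hr'))))))
      (fun i j hi hj hj' h => (hinj r i r j hi hj hj' h).2)
    rw [h0, h1] at e1
    have e2 := ih (fun x => g x * (1 + t ^ len r * (spin x u * spin x v)))
      (fun r' j hj hj' => (hg r' j hj hj').mul ((indepOf_const 1).add ((indepOf_const _).mul
        ((indepOf_spin (hu r' j hj hj')).mul (indepOf_spin (hv r' j hj hj'))))))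
    refine Eq.trans ?_ ((e1.trans ?_).trans (e2.trans ?_))
    · exact Finset.sum_congr rfl fun x _ => by rw [Finset.prod_insert hr]; ring
    · exact Finset.sum_congr rfl fun x _ => by ring
    · exact Finset.sum_congr rfl fun x _ => by rw [Finset.prod_insert hr]; ring

/-- Two vertices joined by parallel paths, in any ferromagnetic environment `E`, disagree with
probability at most `1 / (1 + R)`, where `R = ∏ (1 + t ^ len r) / (1 - t ^ len r)`. The paths
alone contribute the odds `R` for agreement; by Griffiths' inequality the environment does not lower
these odds. -/
lemma disagreement_parallel_paths {ρ : Type*} [Fintype ρ] {t : ℝ} (ht : 0 ≤ t) (ht1 : t < 1)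
    {u v : V} (len : ρ → ℕ) (pth : ρ → ℕ → V)
    (hlen : ∀ r, 1 ≤ len r) (h0 : ∀ r, pth r 0 = u) (h1 : ∀ r, pth r (len r) = v)
    (hinj : ∀ r i r' j, i ≤ len r → 0 < j → j < len r' → pth r i = pth r' j → r = r' ∧ i = j)
    (huv : ∀ r j, 0 < j → j < len r → u ≠ pth r j ∧ v ≠ pth r j)
    (E : Finset (Sym2 V)) (hE : ∀ r j, 0 < j → j < len r → ∀ e ∈ E, pth r j ∉ e) :
    (1 + ∏ r, (1 + t ^ len r) / (1 - t ^ len r)) *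
      ∑ x : V → ℤˣ, (if x u = x v then 0 else 1) * (weight t E x *
        ∏ r, ∏ j ∈ Finset.range (len r),
          (1 + t * (spin x (pth r j) * spin x (pth r (j + 1))))) ≤
      ∑ x : V → ℤˣ, weight t E x * ∏ r, ∏ j ∈ Finset.range (len r),
          (1 + t * (spin x (pth r j) * spin x (pth r (j + 1)))) := by
  set Np : ℝ := ∏ r, (1 + t ^ len r) with hNp
  set Nm : ℝ := ∏ r, (1 - t ^ len r) with hNm
  have hNp0 : 0 < Np := Finset.prod_pos fun r _ => by positivity
  have hNm0 : 0 < Nm := Finset.prod_pos fun r _ => by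
    have : t ^ len r < 1 := pow_lt_one₀ ht ht1 (by have := hlen r; omega)
    linarith
  set w : (V → ℤˣ) → ℝ := weight t E with hw
  have hwi : ∀ r j, 0 < j → j < len r → IndepOf (pth r j) w := fun r j hj hj' =>
    indepOf_weight (hE r j hj hj')
  set Am : ℝ := ∑ x : V → ℤˣ, (if x u = x v then 0 else 1) * w x with hAm
  set Ap : ℝ := ∑ x : V → ℤˣ, (if x u = x v then 1 else 0) * w x with hAp
  have hpm : Am ≤ Ap := by
    have := sum_spin_mul_spin_mul_weight_nonneg ht E u v
    have e : ∑ x : V → ℤˣ, (spin x u * spin x v) * weight t E x = Ap - Am := by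
      rw [hAp, hAm, ← Finset.sum_sub_distrib]
      refine Finset.sum_congr rfl fun x _ => ?_
      rw [spin_mul_spin_eq, ← hw]
      split_ifs <;> ring
    linarith
  have hprod : ∀ x : V → ℤˣ, ∏ r, (1 + t ^ len r * (spin x u * spin x v)) =
      if x u = x v then Np else Nm := by
    intro x
    rw [spin_mul_spin_eq]
    split_ifs
    · simp [hNp]
    · simp [hNm, sub_eq_add_neg]
  have hif : ∀ r j, 0 < j → j < len r →
      IndepOf (pth r j) (fun x : V → ℤˣ => if x u = x v then (0 : ℝ) else 1) := by
    intro r j hj hj' x s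
    simp [Function.update_of_ne (huv r j hj hj').1, Function.update_of_ne (huv r j hj hj').2]
  have e1 := sum_parallel_paths (t := t) len pth hlen h0 h1 hinj Finset.univ
    (fun x => (if x u = x v then 0 else 1) * w x)
    (fun r j hj hj' => (hif r j hj hj').mul (hwi r j hj hj'))
  have e2 := sum_parallel_paths (t := t) len pth hlen h0 h1 hinj Finset.univ w hwi
  simp only [hprod, mul_assoc] at e1
  simp only [hprod] at e2
  rw [e1, e2]
  have e3 : ∑ x : V → ℤˣ, (if x u = x v then 0 else 1) * (w x * if x u = x v then Np else Nm)
      = Nm * Am := by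
    rw [hAm, Finset.mul_sum]
    refine Finset.sum_congr rfl fun x _ => ?_
    split_ifs <;> ring
  have e4 : ∑ x : V → ℤˣ, w x * (if x u = x v then Np else Nm) = Np * Ap + Nm * Am := by
    rw [hAm, hAp, Finset.mul_sum, Finset.mul_sum, ← Finset.sum_add_distrib]
    refine Finset.sum_congr rfl fun x _ => ?_
    split_ifs <;> ring
  rw [e3, e4, Finset.prod_div_distrib, ← hNp, ← hNm]
  have : (1 + Np / Nm) * (Nm * Am) = Nm * Am + Np * Am := by field_simp
  rw [this]
  have := mul_le_mul_of_nonneg_left hpm hNp0.le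
  linarith

end Parallel

/-! ### Graphs made of cores, links and toggled edges -/

/-- A blueprint for a family of graphs on `Fin p`. A link `τ` joins the cores `src τ` and `tgt τ` by
internally disjoint paths, one of length `len r` for each `r : ρ`; these paths belong to every graph
of the family. The edges `tog δ` between cores may be switched on or off independently. `emb` places
the cores and the inner vertices of the paths in `Fin p`; the remaining vertices stay isolated. -/
structure Layout (p : ℕ) (C T ρ Δ : Type) where
  src : T → C
  tgt : T → C
  len : ρ → ℕ
  tog : Δ → Sym2 C
  emb : (C ⊕ (Σ a : T × ρ, Fin (len a.2 - 1))) ↪ Fin p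
  two_le_len : ∀ r, 2 ≤ len r
  src_inj : Function.Injective src
  tgt_inj : Function.Injective tgt
  src_ne_tgt : ∀ τ, src τ ≠ tgt τ
  link_inj : Function.Injective fun τ => s(src τ, tgt τ)
  tog_inj : Function.Injective tog
  tog_not_isDiag : ∀ δ, ¬ (tog δ).IsDiag
  link_tog : ∀ τ, ∃ δ, tog δ = s(src τ, tgt τ)

namespace Layout

variable {p : ℕ} {C T ρ Δ : Type} (L : Layout p C T ρ Δ)

/-- The vertex of a core. -/
def core (c : C) : Fin p := L.emb (Sum.inl c)

/-- The `j`-th vertex of path `r` of link `τ`, from the source core at `j = 0` to the target core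
at `j = len r`. -/
def pos (τ : T) (r : ρ) (j : ℕ) : Fin p :=
  if j = 0 then L.core (L.src τ)
  else if h : j - 1 < L.len r - 1 then L.emb (Sum.inr ⟨(τ, r), ⟨j - 1, h⟩⟩)
  else L.core (L.tgt τ)

/-- `pos`, with the path traversed backwards when `σ` is true. -/
def opos (σ : Bool) (τ : T) (r : ρ) (j : ℕ) : Fin p :=
  if σ then L.pos τ r (L.len r - j) else L.pos τ r j

/-- The initial core of a link, traversed backwards when `σ` is true. -/
def osrc (σ : Bool) (τ : T) : C := if σ then L.tgt τ else L.src τ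

lemma core_inj : Function.Injective L.core := fun _ _ h => Sum.inl_injective (L.emb.injective h)

lemma pos_zero (τ : T) (r : ρ) : L.pos τ r 0 = L.core (L.src τ) := by simp [pos]

lemma pos_len (τ : T) (r : ρ) : L.pos τ r (L.len r) = L.core (L.tgt τ) := by
  have := L.two_le_len r
  rw [pos, if_neg (by omega), dif_neg (by omega)]

lemma pos_inner {τ : T} {r : ρ} {j : ℕ} (h0 : 0 < j) (h1 : j < L.len r) :
    L.pos τ r j = L.emb (Sum.inr ⟨(τ, r), ⟨j - 1, Nat.sub_lt_sub_right h0 h1⟩⟩) := by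
  rw [pos, if_neg (by omega), dif_pos (by omega)]

lemma pos_ne_core {τ : T} {r : ρ} {j : ℕ} (h0 : 0 < j) (h1 : j < L.len r) (c : C) :
    L.pos τ r j ≠ L.core c := by
  rw [L.pos_inner h0 h1, core]
  intro h
  exact Sum.inr_ne_inl (L.emb.injective h)

lemma pos_inj {τ τ' : T} {r r' : ρ} {i j : ℕ} (hi : 0 < i) (hi' : i < L.len r) (hj : 0 < j)
    (hj' : j < L.len r') (h : L.pos τ r i = L.pos τ' r' j) : τ = τ' ∧ r = r' ∧ i = j := by
  rw [L.pos_inner hi hi', L.pos_inner hj hj'] at h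
  have h2 := Sum.inr_injective (L.emb.injective h)
  obtain ⟨h3, h4⟩ := Sigma.mk.inj h2
  obtain ⟨rfl, rfl⟩ := Prod.mk.inj h3
  have h5 := Fin.mk.inj (eq_of_heq h4)
  exact ⟨rfl, rfl, by omega⟩

/-- An inner vertex of a path occurs only once among all positions, end cores included. -/
lemma pos_inj' {τ τ' : T} {r r' : ρ} {i j : ℕ} (hi' : i ≤ L.len r) (hj : 0 < j)
    (hj' : j < L.len r') (h : L.pos τ r i = L.pos τ' r' j) : τ = τ' ∧ r = r' ∧ i = j := by
  rcases Nat.eq_zero_or_pos i with rfl | hi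
  · rw [pos_zero] at h
    exact absurd h.symm (L.pos_ne_core hj hj' _)
  · rcases hi'.lt_or_eq with hi' | rfl
    · exact L.pos_inj hi hi' hj hj' h
    · rw [pos_len] at h
      exact absurd h.symm (L.pos_ne_core hj hj' _)

lemma opos_zero (σ : Bool) (τ : T) (r : ρ) : L.opos σ τ r 0 = L.core (L.osrc σ τ) := by
  cases σ <;> simp [opos, osrc, pos_zero, pos_len]

lemma opos_len (σ : Bool) (τ : T) (r : ρ) : L.opos σ τ r (L.len r) = L.core (L.osrc (!σ) τ) := by
  cases σ <;> simp [opos, osrc, pos_zero, pos_len]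

lemma opos_ne_core {σ : Bool} {τ : T} {r : ρ} {j : ℕ} (h0 : 0 < j) (h1 : j < L.len r) (c : C) :
    L.opos σ τ r j ≠ L.core c := by
  cases σ
  · exact L.pos_ne_core h0 h1 c
  · exact L.pos_ne_core (by omega) (by omega) c

/-- An inner vertex determines its position up to reversing the direction of traversal. -/
lemma opos_inj {σ σ' : Bool} {τ τ' : T} {r r' : ρ} {i j : ℕ} (hi : 0 < i) (hi' : i < L.len r)
    (hj : 0 < j) (hj' : j < L.len r') (h : L.opos σ τ r i = L.opos σ' τ' r' j) :
    τ = τ' ∧ r = r' ∧ ((σ = σ' ∧ i = j) ∨ (σ' = !σ ∧ j = L.len r - i)) := by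
  cases σ <;> cases σ' <;> simp only [opos, if_true, if_false, Bool.false_eq_true] at h
  · obtain ⟨rfl, rfl, h'⟩ := L.pos_inj hi hi' hj hj' h
    exact ⟨rfl, rfl, Or.inl ⟨rfl, h'⟩⟩
  · obtain ⟨rfl, rfl, h'⟩ := L.pos_inj hi hi' (by omega) (by omega) h
    exact ⟨rfl, rfl, Or.inr ⟨rfl, by omega⟩⟩
  · obtain ⟨rfl, rfl, h'⟩ := L.pos_inj (by omega) (by omega) hj hj' h
    exact ⟨rfl, rfl, Or.inr ⟨rfl, by omega⟩⟩
  · obtain ⟨rfl, rfl, h'⟩ := L.pos_inj (by omega) (by omega) (by omega) (by omega) h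
    exact ⟨rfl, rfl, Or.inl ⟨rfl, by omega⟩⟩

lemma opos_not (σ : Bool) (τ : T) (r : ρ) {j : ℕ} (hj : j ≤ L.len r) :
    L.opos (!σ) τ r (L.len r - j) = L.opos σ τ r j := by
  cases σ <;> simp [opos, Nat.sub_sub_self hj]

lemma osrc_inj (σ : Bool) : Function.Injective (L.osrc σ) := by
  cases σ
  · exact L.src_inj
  · exact L.tgt_inj

lemma mk_osrc (σ : Bool) (τ : T) : s(L.osrc σ τ, L.osrc (!σ) τ) = s(L.src τ, L.tgt τ) := by
  cases σ
  · rfl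
  · exact Sym2.eq_swap

/-- The `j`-th edge of path `r` of link `τ`. -/
def pathEdge (a : Σ _ : T × ρ, ℕ) : Sym2 (Fin p) :=
  s(L.pos a.1.1 a.1.2 a.2, L.pos a.1.1 a.1.2 (a.2 + 1))

lemma pos_ne_pos_succ (τ : T) (r : ρ) {j : ℕ} (hj : j < L.len r) :
    L.pos τ r j ≠ L.pos τ r (j + 1) := by
  have h2 := L.two_le_len r
  intro h
  rcases Nat.eq_zero_or_pos j with rfl | h0
  · exact absurd (L.pos_inj' (by omega) (by omega) (by omega) h).2.2 (by omega)
  · exact absurd (L.pos_inj' (by omega) h0 hj h.symm).2.2 (by omega)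

variable [Fintype ρ]

open Classical in
/-- The edges of all paths of the links in `s`. -/
noncomputable def pathEdges (s : Finset T) : Finset (Sym2 (Fin p)) :=
  ((s ×ˢ Finset.univ).sigma fun a : T × ρ => Finset.range (L.len a.2)).image L.pathEdge

lemma mem_pathEdges {s : Finset T} {x y : Fin p} : s(x, y) ∈ L.pathEdges s ↔
    ∃ σ, ∃ τ ∈ s, ∃ r j, j < L.len r ∧ x = L.opos σ τ r j ∧ y = L.opos σ τ r (j + 1) := by
  simp only [pathEdges, Finset.mem_image, Finset.mem_sigma, Finset.mem_range, Finset.mem_product,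
    Finset.mem_univ, and_true]
  constructor
  · rintro ⟨⟨⟨τ, r⟩, j⟩, ⟨hτ, hj⟩, h⟩
    simp only at hj hτ
    rcases Sym2.eq_iff.1 h with ⟨h1, h2⟩ | ⟨h1, h2⟩
    · exact ⟨false, τ, hτ, r, j, hj, by simp [opos, ← h1], by simp [opos, ← h2]⟩
    · refine ⟨true, τ, hτ, r, L.len r - j - 1, by omega, ?_, ?_⟩
      · simp only [opos, if_true, ← h2]
        congr 1; omega
      · simp only [opos, if_true, ← h1]
        congr 1; omega
  · rintro ⟨σ, τ, hτ, r, j, hj, rfl, rfl⟩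
    cases σ
    · exact ⟨⟨(τ, r), j⟩, ⟨hτ, hj⟩, rfl⟩
    · refine ⟨⟨(τ, r), L.len r - j - 1⟩, ⟨hτ, by simp only; omega⟩, ?_⟩
      simp only [pathEdge, opos, if_true]
      have e1 : L.len r - j - 1 = L.len r - (j + 1) := by omega
      have e2 : L.len r - j - 1 + 1 = L.len r - j := by omega
      rw [Sym2.eq_swap, e2, e1]

variable [Fintype T]

open Classical in
/-- The edges of the graph in which the toggles in `A` are switched on. -/
noncomputable def edges (A : Finset Δ) : Finset (Sym2 (Fin p)) :=
  A.image (fun δ => (L.tog δ).map L.core) ∪ L.pathEdges Finset.univ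

/-- The graph in which the toggles in `A` are switched on. -/
noncomputable def graph (A : Finset Δ) : SimpleGraph (Fin p) :=
  SimpleGraph.fromEdgeSet (L.edges A : Set (Sym2 (Fin p)))

lemma edgeSet_graph (A : Finset Δ) : (L.graph A).edgeSet = ↑(L.edges A) := by
  rw [graph, SimpleGraph.edgeSet_fromEdgeSet, sdiff_eq_left, Set.disjoint_left]
  intro e he hd
  simp only [edges, pathEdges, Finset.coe_union, Set.mem_union, Finset.mem_coe, Finset.mem_image,
    Finset.mem_sigma, Finset.mem_range] at he
  rcases he with ⟨δ, _, rfl⟩ | ⟨⟨⟨τ, r⟩, j⟩, ⟨_, hj⟩, rfl⟩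
  · exact L.tog_not_isDiag δ ((Sym2.isDiag_map L.core_inj).1 hd)
  · exact L.pos_ne_pos_succ τ r hj hd

lemma mem_edges {A : Finset Δ} {x y : Fin p} : s(x, y) ∈ L.edges A ↔
    (∃ δ ∈ A, s(x, y) = (L.tog δ).map L.core) ∨
      ∃ σ τ r j, j < L.len r ∧ x = L.opos σ τ r j ∧ y = L.opos σ τ r (j + 1) := by
  rw [edges, Finset.mem_union, mem_pathEdges, Finset.mem_image]
  simp only [Finset.mem_univ, true_and, eq_comm (a := s(x, y))]

lemma adj_iff {A : Finset Δ} {x y : Fin p} : (L.graph A).Adj x y ↔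
    (∃ δ ∈ A, s(x, y) = (L.tog δ).map L.core) ∨
      ∃ σ τ r j, j < L.len r ∧ x = L.opos σ τ r j ∧ y = L.opos σ τ r (j + 1) := by
  rw [← SimpleGraph.mem_edgeSet, edgeSet_graph, Finset.mem_coe, mem_edges]

lemma ncard_edgeSet_le [Fintype Δ] (A : Finset Δ) :
    (L.graph A).edgeSet.ncard ≤ Fintype.card Δ + Fintype.card T * ∑ r, L.len r := by
  classical
  rw [edgeSet_graph, Set.ncard_coe_finset, edges]
  refine (Finset.card_union_le _ _).trans (add_le_add ?_ ?_)
  · exact Finset.card_image_le.trans (Finset.card_le_univ A)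
  · refine Finset.card_image_le.trans ?_
    rw [Finset.card_sigma, Finset.sum_product]
    simp

end Layout

/-! ### Membership in the sparse separator class -/

/-- A vertex with at most `η` neighbours is separated by them from every other vertex that is not
adjacent to it. -/
lemma exists_separator_of_ncard_neighborSet_le {V : Type*} [Finite V] {G : SimpleGraph V} {η : ℕ}
    (γ : ℕ) {u v : V} (huv : u ≠ v) (hadj : ¬ G.Adj u v) (h : (G.neighborSet u).ncard ≤ η) :
    ∃ S : Finset V, S.card ≤ η ∧ u ∉ S ∧ v ∉ S ∧
      ∀ w : G.Walk u v, w.IsPath → w.length ≤ γ → ∃ s ∈ S, s ∈ w.support := by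
  have hfin := Set.toFinite (G.neighborSet u)
  refine ⟨hfin.toFinset, ?_, by simp, by simpa using hadj, ?_⟩
  · rwa [← Set.ncard_eq_toFinset_card _ hfin]
  · intro w _ _
    cases w with
    | nil => exact absurd rfl huv
    | cons h w => exact ⟨_, by simpa using h, by simp⟩

/-- Separation is symmetric in the two vertices. -/
lemma exists_separator_symm {V : Type*} {G : SimpleGraph V} {η γ : ℕ} {u v : V}
    (h : ∃ S : Finset V, S.card ≤ η ∧ u ∉ S ∧ v ∉ S ∧
      ∀ w : G.Walk u v, w.IsPath → w.length ≤ γ → ∃ s ∈ S, s ∈ w.support) :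
    ∃ S : Finset V, S.card ≤ η ∧ v ∉ S ∧ u ∉ S ∧
      ∀ w : G.Walk v u, w.IsPath → w.length ≤ γ → ∃ s ∈ S, s ∈ w.support := by
  obtain ⟨S, h1, h2, h3, h4⟩ := h
  refine ⟨S, h1, h3, h2, fun w hw hl => ?_⟩
  obtain ⟨s, hs, hs'⟩ := h4 w.reverse hw.reverse (by simpa using hl)
  exact ⟨s, hs, by simpa using hs'⟩

namespace Layout

variable {p : ℕ} {C T ρ Δ : Type} (L : Layout p C T ρ Δ)

lemma eq_map_core_iff {x y : Fin p} {e : Sym2 C} :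
    s(x, y) = e.map L.core ↔ ∃ u c, x = L.core u ∧ y = L.core c ∧ e = s(u, c) := by
  induction e with | _ i j =>
  rw [Sym2.map_mk]
  constructor
  · intro h
    rcases Sym2.eq_iff.1 h with ⟨h1, h2⟩ | ⟨h1, h2⟩
    · exact ⟨i, j, h1, h2, rfl⟩
    · exact ⟨j, i, h1, h2, Sym2.eq_swap⟩
  · rintro ⟨u, c, rfl, rfl, h⟩
    have := congrArg (Sym2.map L.core) h
    simpa using this.symm

/-- The cores that a toggle may join to the core `u`. -/
def togNbrs (u : C) : Set C := {c | ∃ δ, L.tog δ = s(u, c)}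

variable [Fintype T] [Fintype ρ]

/-- A vertex that is not a core has at most two neighbours. -/
lemma ncard_neighborSet_le_two {A : Finset Δ} {x : Fin p} (hx : ∀ c, x ≠ L.core c) :
    ((L.graph A).neighborSet x).ncard ≤ 2 := by
  rcases Set.eq_empty_or_nonempty ((L.graph A).neighborSet x) with h | ⟨y, hy⟩
  · simp [h]
  · rw [SimpleGraph.mem_neighborSet, adj_iff] at hy
    rcases hy with ⟨δ, _, h⟩ | ⟨σ, τ, r, j, hj, rfl, rfl⟩
    · obtain ⟨u, c, h1, _⟩ := L.eq_map_core_iff.1 h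
      exact absurd h1 (hx u)
    have h0 : 0 < j := by
      rcases Nat.eq_zero_or_pos j with rfl | h
      · exact absurd (L.opos_zero σ τ r) (hx _)
      · exact h
    have hsub : (L.graph A).neighborSet (L.opos σ τ r j) ⊆
        {L.opos σ τ r (j + 1), L.opos σ τ r (j - 1)} := by
      intro z hz
      rw [SimpleGraph.mem_neighborSet, adj_iff] at hz
      rcases hz with ⟨δ, _, h⟩ | ⟨σ', τ', r', j', hj', h, rfl⟩
      · obtain ⟨u, c, h1, _⟩ := L.eq_map_core_iff.1 h
        exact absurd h1 (hx u)
      have h0' : 0 < j' := by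
        rcases Nat.eq_zero_or_pos j' with rfl | h'
        · rw [opos_zero] at h
          exact absurd h (hx _)
        · exact h'
      obtain ⟨rfl, rfl, ⟨rfl, rfl⟩ | ⟨rfl, rfl⟩⟩ := L.opos_inj h0 hj h0' hj' h
      · simp
      · right
        have e : L.len r - j + 1 = L.len r - (j - 1) := by omega
        rw [e, opos_not _ _ _ _ (by omega)]
        rfl
    calc _ ≤ _ := Set.ncard_le_ncard hsub (Set.toFinite _)
      _ ≤ 2 := (Set.ncard_insert_le _ _).trans (by rw [Set.ncard_singleton])

lemma ncard_neighborSet_core_le [Finite C] (A : Finset Δ) (u : C) :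
    ((L.graph A).neighborSet (L.core u)).ncard ≤
      (L.togNbrs u).ncard + 2 * Fintype.card ρ := by
  classical
  set P : Bool → Set (Fin p) := fun σ => {x | ∃ τ r, L.osrc σ τ = u ∧ x = L.opos σ τ r 1} with hP
  have hPc : ∀ σ, (P σ).ncard ≤ Fintype.card ρ := by
    intro σ
    by_cases h : ∃ τ, L.osrc σ τ = u
    · obtain ⟨τ, hτ⟩ := h
      have : P σ ⊆ (fun r => L.opos σ τ r 1) '' Set.univ := by
        rintro x ⟨τ', r, h', rfl⟩
        rw [L.osrc_inj σ (h'.trans hτ.symm)]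
        exact ⟨r, trivial, rfl⟩
      calc _ ≤ _ := Set.ncard_le_ncard this (Set.toFinite _)
        _ ≤ _ := Set.ncard_image_le Set.finite_univ
        _ = _ := by rw [Set.ncard_univ, Nat.card_eq_fintype_card]
    · have : P σ = ∅ := by
        rw [Set.eq_empty_iff_forall_notMem]
        rintro x ⟨τ, r, h', _⟩
        exact h ⟨τ, h'⟩
      simp [this]
  have hsub : (L.graph A).neighborSet (L.core u) ⊆
      L.core '' (L.togNbrs u) ∪ (P false ∪ P true) := by
    intro y hy
    rw [SimpleGraph.mem_neighborSet, adj_iff] at hy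
    rcases hy with ⟨δ, _, h⟩ | ⟨σ, τ, r, j, hj, h, rfl⟩
    · obtain ⟨u', c, h1, rfl, h2⟩ := L.eq_map_core_iff.1 h
      rw [← L.core_inj h1] at h2
      exact Or.inl ⟨c, ⟨δ, h2⟩, rfl⟩
    · rcases Nat.eq_zero_or_pos j with rfl | h0
      · rw [opos_zero] at h
        have : L.opos σ τ r (0 + 1) ∈ P σ := ⟨τ, r, (L.core_inj h).symm, rfl⟩
        cases σ
        · exact Or.inr (Or.inl this)
        · exact Or.inr (Or.inr this)
      · exact absurd h.symm (L.opos_ne_core h0 hj u)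
  calc _ ≤ _ := Set.ncard_le_ncard hsub (Set.toFinite _)
    _ ≤ (L.core '' L.togNbrs u).ncard + (P false ∪ P true).ncard := Set.ncard_union_le _ _
    _ ≤ (L.togNbrs u).ncard + ((P false).ncard + (P true).ncard) :=
        add_le_add (Set.ncard_image_le (Set.toFinite _)) (Set.ncard_union_le _ _)
    _ ≤ _ := by have := hPc false; have := hPc true; omega

/-- The vertices that a walk of length `l` from the core `u` can reach without passing through
another core: `u` itself, midpoints of the short paths at `u`, and the first `l` inner vertices of
the other paths at `u`. -/
def Near (short : Finset ρ) (u : C) (l : ℕ) (x : Fin p) : Prop :=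
  x = L.core u ∨ ∃ σ τ r j, L.osrc σ τ = u ∧ x = L.opos σ τ r j ∧ 0 < j ∧ j < L.len r ∧
    (r ∈ short ∨ j ≤ l)

/-- Two cores that are not adjacent are separated by the toggle neighbours of the first one and by
the midpoints of the short paths between them: the longer paths have more than `γ` edges. -/
lemma exists_separator_core [Finite C] (A : Finset Δ) {η γ : ℕ} (short : Finset ρ)
    (hs : ∀ r ∈ short, L.len r = 2) (hl : ∀ r ∉ short, L.len r = γ + 1)
    {u v : C} (hη : (L.togNbrs u).ncard + short.card ≤ η)
    (huv : u ≠ v) (hadj : ¬ (L.graph A).Adj (L.core u) (L.core v)) :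
    ∃ S : Finset (Fin p), S.card ≤ η ∧ L.core u ∉ S ∧ L.core v ∉ S ∧
      ∀ w : (L.graph A).Walk (L.core u) (L.core v), w.IsPath → w.length ≤ γ →
        ∃ s ∈ S, s ∈ w.support := by
  classical
  set M : Set (Fin p) := {x | ∃ σ τ, ∃ r ∈ short, L.osrc σ τ = u ∧ L.osrc (!σ) τ = v ∧
    x = L.opos σ τ r 1} with hM
  set S₀ : Set (Fin p) := L.core '' (L.togNbrs u \ {v}) ∪ M with hS₀
  have hfin : S₀.Finite := Set.toFinite _
  -- Linked cores are joined by a toggle, so if `v` is linked to `u`, leaving `v` out of the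
  -- neighbours pays for one of the midpoints in `M`.
  have hlink : ∀ σ τ, L.osrc σ τ = u → L.osrc (!σ) τ ∈ L.togNbrs u := by
    rintro σ τ rfl
    obtain ⟨δ, hδ⟩ := L.link_tog τ
    exact ⟨δ, by rw [hδ, mk_osrc]⟩
  have hself : u ∉ L.togNbrs u := by
    rintro ⟨δ, hδ⟩
    exact L.tog_not_isDiag δ (by rw [hδ]; exact Sym2.mk_isDiag_iff.2 rfl)
  have hcard : S₀.ncard ≤ η := by
    have h1 : S₀.ncard ≤ (L.togNbrs u \ {v}).ncard + M.ncard :=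
      (Set.ncard_union_le _ _).trans
        (Nat.add_le_add_right (Set.ncard_image_le (Set.toFinite _)) _)
    by_cases h : ∃ σ τ, L.osrc σ τ = u ∧ L.osrc (!σ) τ = v
    · obtain ⟨σ, τ, hu, hv⟩ := h
      have hMs : M ⊆ (short.image fun r => L.opos σ τ r 1 : Finset (Fin p)) := by
        rintro x ⟨σ', τ', r, hr, hu', hv', rfl⟩
        have e : τ' = τ := L.link_inj (by
          show s(L.src τ', L.tgt τ') = s(L.src τ, L.tgt τ)
          rw [← L.mk_osrc σ' τ', ← L.mk_osrc σ τ, hu, hv, hu', hv'])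
        subst e
        have e' : σ' = σ := by
          by_contra hne
          have : σ' = !σ := by cases σ <;> cases σ' <;> simp_all
          rw [this, hv] at hu'
          exact huv hu'.symm
        subst e'
        exact Finset.mem_coe.2 (Finset.mem_image_of_mem _ hr)
      have h2 : M.ncard ≤ short.card := by
        refine (Set.ncard_le_ncard hMs (Finset.finite_toSet _)).trans ?_
        rw [Set.ncard_coe_finset]
        exact Finset.card_image_le
      have h3 := Set.ncard_sdiff_singleton_add_one (hv ▸ hlink σ τ hu) (Set.toFinite (L.togNbrs u))
      omega
    · have : M = ∅ := by
        rw [Set.eq_empty_iff_forall_notMem]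
        rintro x ⟨σ, τ, r, _, hu, hv, _⟩
        exact h ⟨σ, τ, hu, hv⟩
      rw [this, Set.ncard_empty] at h1
      have := Set.ncard_le_ncard (Set.sdiff_subset (s := L.togNbrs u) (t := {v})) (Set.toFinite _)
      omega
  have hMcore : ∀ c, L.core c ∉ M := by
    rintro c ⟨σ, τ, r, hr, _, _, h⟩
    exact L.opos_ne_core (by omega) (by rw [hs r hr]; omega) c h.symm
  have hcoreS : ∀ c, L.core c ∈ S₀ → c ∈ L.togNbrs u ∧ c ≠ v := by
    intro c hc
    rcases hc with ⟨c', hc', h⟩ | h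
    · rw [← L.core_inj h]
      exact ⟨hc'.1, hc'.2⟩
    · exact absurd h (hMcore c)
  have step : ∀ l x y, l + 1 ≤ γ → L.Near short u l x → (L.graph A).Adj x y → x ∉ S₀ → y ∉ S₀ →
      L.Near short u (l + 1) y := by
    intro l x y hlγ hx hxy hxS hyS
    have hx' : x = L.core u ∨ ∀ c, x ≠ L.core c := by
      rcases hx with h | ⟨σ, τ, r, j, _, rfl, h0, h1, _⟩
      · exact Or.inl h
      · exact Or.inr fun c => L.opos_ne_core h0 h1 c
    rcases L.adj_iff.1 hxy with ⟨δ, hδ, h⟩ | ⟨σ', τ', r', j', hj', h, rfl⟩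
    · obtain ⟨u', c, rfl, rfl, h2⟩ := L.eq_map_core_iff.1 h
      have hu' : u' = u := by
        rcases hx' with h | h
        · exact L.core_inj h
        · exact absurd rfl (h u')
      subst hu'
      refine absurd (Or.inl ⟨c, ⟨⟨δ, h2⟩, ?_⟩, rfl⟩) hyS
      rintro rfl
      exact hadj hxy
    · rcases Nat.eq_zero_or_pos j' with rfl | h0'
      · rw [opos_zero] at h
        rcases hx' with h' | h'
        · refine Or.inr ⟨σ', τ', r', 0 + 1, L.core_inj (h.symm.trans h'), rfl, by omega, ?_,
            Or.inr (by omega)⟩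
          have := L.two_le_len r'
          omega
        · exact absurd h (h' _)
      · rcases hx with rfl | ⟨σ, τ, r, j, hu, rfl, h0, h1, hr⟩
        · exact absurd h.symm (L.opos_ne_core h0' hj' u)
        obtain ⟨rfl, rfl, ⟨rfl, rfl⟩ | ⟨rfl, rfl⟩⟩ := L.opos_inj h0 h1 h0' hj' h
        · rcases Nat.lt_or_ge (j + 1) (L.len r) with h2 | h2
          · refine Or.inr ⟨σ, τ, r, j + 1, hu, rfl, by omega, h2, hr.imp_right ?_⟩
            omega
          · have e : j + 1 = L.len r := by omega
            by_cases hrs : r ∈ short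
            · exfalso
              rw [e, opos_len] at hyS
              have hne : L.osrc (!σ) τ = v := by
                by_contra hne
                exact hyS (Or.inl ⟨_, ⟨hlink σ τ hu, hne⟩, rfl⟩)
              have hj1 : j = 1 := by have := hs r hrs; omega
              subst hj1
              exact hxS (Or.inr ⟨σ, τ, r, hrs, hu, hne, rfl⟩)
            · have := hl r hrs
              have := hr.resolve_left hrs
              omega
        · have e : L.len r - j + 1 = L.len r - (j - 1) := by omega
          rw [e, opos_not _ _ _ _ (by omega)]
          rcases Nat.eq_zero_or_pos (j - 1) with h2 | h2
          · rw [h2, opos_zero, hu]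
            exact Or.inl rfl
          · exact Or.inr ⟨σ, τ, r, j - 1, hu, rfl, h2, by omega, hr.imp_right (by omega)⟩
  have walk : ∀ x y (w : (L.graph A).Walk x y) l, L.Near short u l x → l + w.length ≤ γ →
      (∀ s ∈ w.support, s ∉ S₀) → L.Near short u (l + w.length) y := by
    intro x y w
    induction w with
    | nil => intro l hx _ _; simpa using hx
    | cons h w ih =>
      intro l hx hlen hS
      rw [SimpleGraph.Walk.length_cons] at hlen ⊢
      have h2 := ih (l + 1) (step l _ _ (by omega) hx h (hS _ (by simp)) (hS _ (by simp)))
        (by omega) (fun s hs => hS s (by simp [hs]))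
      rwa [add_assoc, add_comm 1] at h2
  refine ⟨hfin.toFinset, ?_, ?_, ?_, ?_⟩
  · rwa [← Set.ncard_eq_toFinset_card _ hfin]
  · rw [Set.Finite.mem_toFinset]
    exact fun h => hself (hcoreS u h).1
  · rw [Set.Finite.mem_toFinset]
    exact fun h => (hcoreS v h).2 rfl
  · intro w _ hw
    by_contra hcon
    push Not at hcon
    have := walk _ _ w 0 (Or.inl rfl) (by omega) fun s hs hsS =>
      hcon s (hfin.mem_toFinset.2 hsS) hs
    rcases this with h | ⟨σ, τ, r, j, _, h, h0, h1, _⟩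
    · exact huv (L.core_inj h).symm
    · exact L.opos_ne_core h0 h1 v h.symm

lemma graph_mem_class [Finite C] [Fintype Δ] (A : Finset Δ) {k d η γ a : ℕ} (short : Finset ρ)
    (hs : ∀ r ∈ short, L.len r = 2) (hl : ∀ r ∉ short, L.len r = γ + 1)
    (ha : ∀ u, (L.togNbrs u).ncard ≤ a) (hη : a + short.card ≤ η) (hη2 : 2 ≤ η)
    (hd : a + 2 * Fintype.card ρ ≤ d) (hd2 : 2 ≤ d)
    (hk : Fintype.card Δ + Fintype.card T * ∑ r, L.len r ≤ k) :
    L.graph A ∈ sparseSeparatorClass p k d η γ := by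
  refine ⟨(L.ncard_edgeSet_le A).trans hk, fun x => ?_, fun x y hxy hadj => ?_⟩
  · by_cases hx : ∃ c, L.core c = x
    · obtain ⟨c, rfl⟩ := hx
      have := L.ncard_neighborSet_core_le A c
      have := ha c
      omega
    · exact (L.ncard_neighborSet_le_two fun c h => hx ⟨c, h.symm⟩).trans hd2
  · by_cases hx : ∃ c, L.core c = x
    · by_cases hy : ∃ c, L.core c = y
      · obtain ⟨u, rfl⟩ := hx
        obtain ⟨v, rfl⟩ := hy
        exact L.exists_separator_core A short hs hl (by have := ha u; omega)
          (fun h => hxy (by rw [h])) hadj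
      · exact exists_separator_symm (exists_separator_of_ncard_neighborSet_le γ hxy.symm
          (fun h => hadj h.symm)
          ((L.ncard_neighborSet_le_two fun c h => hy ⟨c, h.symm⟩).trans hη2))
    · exact exists_separator_of_ncard_neighborSet_le γ hxy hadj
        ((L.ncard_neighborSet_le_two fun c h => hx ⟨c, h.symm⟩).trans hη2)

end Layout

/-! ### Disagreement probabilities and relative entropy -/

/-- The probability that the spins at `u` and `v` differ. -/
noncomputable def disagree {p : ℕ} (lam : ℝ) (G : SimpleGraph (Fin p)) (u v : Fin p) : ℝ :=
  ∑ x, prob lam G x * (if x u = x v then 0 else 1)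

lemma disagree_comm {p : ℕ} (lam : ℝ) (G : SimpleGraph (Fin p)) (u v : Fin p) :
    disagree lam G u v = disagree lam G v u := by
  simp only [disagree, eq_comm]

lemma disagree_self {p : ℕ} (lam : ℝ) (G : SimpleGraph (Fin p)) (u : Fin p) :
    disagree lam G u u = 0 := by
  simp [disagree]

lemma disagree_triangle {p : ℕ} (lam : ℝ) (G : SimpleGraph (Fin p)) (u v w : Fin p) :
    disagree lam G u w ≤ disagree lam G u v + disagree lam G v w := by
  unfold disagree
  rw [← Finset.sum_add_distrib]
  refine Finset.sum_le_sum fun x _ => ?_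
  rw [← mul_add]
  refine mul_le_mul_of_nonneg_left ?_ (prob_pos _ _ _).le
  by_cases h1 : x u = x v
  · simp [h1]
  · rw [if_neg h1]
    split_ifs <;> norm_num

namespace Layout

variable {p : ℕ} {C T ρ Δ : Type} (L : Layout p C T ρ Δ)

lemma pos_ne_pos_add_two (τ : T) (r : ρ) {j : ℕ} (hj : j + 2 ≤ L.len r) :
    L.pos τ r j ≠ L.pos τ r (j + 2) := by
  intro h
  rcases Nat.eq_zero_or_pos j with rfl | h0
  · rcases hj.lt_or_eq with h2 | h2
    · exact absurd (L.pos_inj' (by omega) (by omega) h2 h).2.2 (by omega)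
    · rw [h2, pos_len, pos_zero] at h
      exact L.src_ne_tgt τ (L.core_inj h)
  · exact absurd (L.pos_inj' hj h0 (by omega) h.symm).2.2 (by omega)

lemma pathEdge_inj {τ τ' : T} {r r' : ρ} {j j' : ℕ} (hj : j < L.len r) (hj' : j' < L.len r')
    (h : L.pathEdge ⟨(τ, r), j⟩ = L.pathEdge ⟨(τ', r'), j'⟩) : τ = τ' ∧ r = r' ∧ j = j' := by
  have hlen := L.two_le_len r
  rcases Sym2.eq_iff.1 h with ⟨h1, h2⟩ | ⟨h1, h2⟩ <;> simp only at h1 h2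
  · rcases Nat.eq_zero_or_pos j with rfl | h0
    · obtain ⟨rfl, rfl, h3⟩ := L.pos_inj' (by omega) (by omega) (by omega) h2.symm
      exact ⟨rfl, rfl, by omega⟩
    · obtain ⟨rfl, rfl, h3⟩ := L.pos_inj' hj'.le h0 hj h1.symm
      exact ⟨rfl, rfl, h3.symm⟩
  · exfalso
    rcases Nat.eq_zero_or_pos j with rfl | h0
    · obtain ⟨rfl, rfl, rfl⟩ := L.pos_inj' hj'.le (by omega) (by omega) h2.symm
      exact L.pos_ne_pos_add_two τ' r' hlen h1
    · obtain ⟨rfl, rfl, h3⟩ := L.pos_inj' (by omega) h0 hj h1.symm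
      subst h3
      exact L.pos_ne_pos_add_two τ' r' hj h2.symm

lemma map_tog_inj : Function.Injective fun δ => (L.tog δ).map L.core := fun _ _ h =>
  L.tog_inj (Sym2.map.injective L.core_inj h)

variable [Fintype ρ]

/-- The odds of agreement that the paths of a single link provide. -/
noncomputable def odds (t : ℝ) : ℝ := ∏ r, (1 + t ^ L.len r) / (1 - t ^ L.len r)

lemma odds_nonneg {t : ℝ} (ht : 0 ≤ t) (ht1 : t ≤ 1) : 0 ≤ L.odds t :=
  Finset.prod_nonneg fun r _ => div_nonneg (by positivity)
    (by have := pow_le_one₀ (n := L.len r) ht ht1; linarith)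

lemma map_tog_notMem_pathEdges (δ : Δ) (s : Finset T) :
    (L.tog δ).map L.core ∉ L.pathEdges s := by
  intro h
  obtain ⟨i, j, hij⟩ : ∃ i j, L.tog δ = s(i, j) := ⟨_, _, (Quot.out_eq (L.tog δ)).symm⟩
  rw [hij, Sym2.map_mk, mem_pathEdges] at h
  obtain ⟨σ, τ, _, r, l, hl, h1, h2⟩ := h
  have := L.two_le_len r
  rcases Nat.eq_zero_or_pos l with rfl | h0
  · exact L.opos_ne_core (by omega) (by omega) _ h2.symm
  · exact L.opos_ne_core h0 hl _ h1.symm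

variable [Fintype T]

lemma map_tog_mem_edges {A : Finset Δ} {δ : Δ} :
    (L.tog δ).map L.core ∈ L.edges A ↔ δ ∈ A := by
  classical
  rw [edges, Finset.mem_union, or_iff_left (L.map_tog_notMem_pathEdges δ _)]
  exact L.map_tog_inj.mem_finset_image

/-- The weight splits into the paths of one link and the rest, which does not touch their inner
vertices. -/
lemma weight_edges (t : ℝ) (A : Finset Δ) (τ : T) (x : Config p) :
    weight t (L.edges A) x = weight t (L.edges A \ L.pathEdges {τ}) x *
      ∏ r, ∏ j ∈ Finset.range (L.len r),
        (1 + t * (spin x (L.pos τ r j) * spin x (L.pos τ r (j + 1)))) := by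
  classical
  have hsub : L.pathEdges {τ} ⊆ L.edges A := by
    refine Finset.Subset.trans ?_ Finset.subset_union_right
    exact Finset.image_subset_image (Finset.sigma_mono
      (Finset.product_subset_product_left (Finset.subset_univ _)) fun _ => subset_rfl)
  have e : ∏ e ∈ L.pathEdges {τ}, (1 + t * bond x e) = ∏ r, ∏ j ∈ Finset.range (L.len r),
        (1 + t * (spin x (L.pos τ r j) * spin x (L.pos τ r (j + 1)))) := by
    rw [pathEdges, Finset.prod_image, Finset.prod_sigma, Finset.prod_product, Finset.prod_singleton]
    · rfl
    · rintro ⟨⟨τ', r⟩, j⟩ h ⟨⟨τ'', r'⟩, j'⟩ h' heq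
      simp only [Finset.coe_sigma, Set.mem_sigma_iff, Finset.mem_coe, Finset.mem_range] at h h'
      obtain ⟨rfl, rfl, rfl⟩ := L.pathEdge_inj h.2 h'.2 heq
      rfl
  rw [← e, weight, weight, Finset.prod_sdiff hsub]

lemma disagree_link_le {lam : ℝ} (hlam : 0 < lam) (A : Finset Δ) (τ : T) :
    disagree lam (L.graph A) (L.core (L.src τ)) (L.core (L.tgt τ)) ≤
      1 / (1 + L.odds (Real.tanh lam)) := by
  classical
  set t := Real.tanh lam
  have ht : 0 ≤ t := (tanh_pos hlam).le
  have ht1 : t < 1 := Real.tanh_lt_one lam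
  have hZ : 0 < ∑ x : Config p, weight t (L.edges A) x :=
    lt_of_lt_of_le (by positivity) (two_pow_le_sum_weight ht (L.edges A))
  have key := disagreement_parallel_paths ht ht1 (u := L.core (L.src τ)) (v := L.core (L.tgt τ))
    L.len (L.pos τ) (fun r => one_le_two.trans (L.two_le_len r)) (L.pos_zero τ) (L.pos_len τ)
    (fun r i r' j hi hj hj' h => (L.pos_inj' hi hj hj' h).2)
    (fun r j hj hj' => ⟨(L.pos_ne_core hj hj' _).symm, (L.pos_ne_core hj hj' _).symm⟩)
    (L.edges A \ L.pathEdges {τ}) (by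
      intro r j hj hj' e he hmem
      obtain ⟨he1, he2⟩ := Finset.mem_sdiff.1 he
      obtain ⟨y, rfl⟩ := Sym2.mem_iff_exists.1 hmem
      rcases L.mem_edges.1 he1 with ⟨δ, _, h⟩ | ⟨σ, τ', r', j', hl, h1, h2⟩
      · obtain ⟨c, _, h1, _⟩ := L.eq_map_core_iff.1 h
        exact L.pos_ne_core hj hj' c h1
      · refine he2 (L.mem_pathEdges.2 ⟨σ, τ', ?_, r', j', hl, h1, h2⟩)
        have h0 : 0 < j' := by
          rcases Nat.eq_zero_or_pos j' with rfl | h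
          · rw [opos_zero] at h1
            exact absurd h1 (L.pos_ne_core hj hj' _)
          · exact h
        have h1' : L.opos false τ r j = L.opos σ τ' r' j' := h1
        rw [(L.opos_inj hj hj' h0 hl h1').1]
        exact Finset.mem_singleton_self _)
  simp only [← L.weight_edges t A τ] at key
  have hR := L.odds_nonneg ht ht1.le
  rw [le_div_iff₀ (by linarith), disagree]
  simp only [prob_eq lam (L.graph A) (L.edges A) (L.edgeSet_graph A), div_mul_eq_mul_div]
  rw [← Finset.sum_div, div_mul_eq_mul_div, div_le_one hZ, mul_comm]
  refine le_trans (le_of_eq ?_) key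
  rw [odds]
  congr 1
  exact Finset.sum_congr rfl fun x _ => mul_comm _ _

/-- Cores at link distance at most `s` disagree with probability at most `s / (1 + odds)`. -/
lemma disagree_chain_le {lam : ℝ} (hlam : 0 < lam) (A : Finset Δ) (c : ℕ → C) (s : ℕ)
    (hc : ∀ l < s, ∃ τ, s(c l, c (l + 1)) = s(L.src τ, L.tgt τ)) :
    disagree lam (L.graph A) (L.core (c 0)) (L.core (c s)) ≤
      s / (1 + L.odds (Real.tanh lam)) := by
  induction s with
  | zero => simp [disagree_self]
  | succ s ih =>
    have h1 := ih fun l hl => hc l (by omega)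
    have h2 : disagree lam (L.graph A) (L.core (c s)) (L.core (c (s + 1))) ≤
        1 / (1 + L.odds (Real.tanh lam)) := by
      obtain ⟨τ, hτ⟩ := hc s (by omega)
      have h3 := L.disagree_link_le hlam A τ
      rcases Sym2.eq_iff.1 hτ with ⟨h, h'⟩ | ⟨h, h'⟩
      · rw [h, h']; exact h3
      · rw [h, h', disagree_comm]; exact h3
    have h4 := disagree_triangle lam (L.graph A) (L.core (c 0)) (L.core (c s)) (L.core (c (s + 1)))
    have h5 : ((s + 1 : ℕ) : ℝ) / (1 + L.odds (Real.tanh lam)) =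
        s / (1 + L.odds (Real.tanh lam)) + 1 / (1 + L.odds (Real.tanh lam)) := by
      push_cast; ring
    linarith

/-- The edit distance to any graph `H` is at least the number of toggles whose state differs
from `H`. -/
lemma card_symmDiff_le_editDist [DecidableEq Δ] (H : SimpleGraph (Fin p)) (A B : Finset Δ)
    (hB : ∀ δ, δ ∈ B ↔ (L.tog δ).map L.core ∈ H.edgeSet) :
    (symmDiff A B).card ≤ editDist (L.graph A) H := by
  classical
  rw [editDist, ← Finset.card_image_of_injective _ L.map_tog_inj, ← Set.ncard_coe_finset]
  refine Set.ncard_le_ncard ?_ (Set.toFinite _)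
  intro e he
  obtain ⟨δ, hδ, rfl⟩ := Finset.mem_image.1 (Finset.mem_coe.1 he)
  rw [Set.mem_symmDiff, edgeSet_graph, Finset.mem_coe, map_tog_mem_edges, ← hB]
  exact Finset.mem_symmDiff.1 hδ

variable [Fintype Δ]

/-- Relative to the graph with all toggles on, each absent toggle costs at most
`2 lam` times the probability that its ends disagree. -/
lemma relEntropy_le {lam B : ℝ} (hlam : 0 < lam) (A : Finset Δ) (hB : 0 ≤ B)
    (h : ∀ δ i j, L.tog δ = s(i, j) → disagree lam (L.graph A) (L.core i) (L.core j) ≤ B) :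
    relEntropy lam (L.graph A) (L.graph Finset.univ) ≤ Fintype.card Δ * (2 * lam * B) := by
  classical
  set β : Δ → Config p → ℝ := fun δ x => bond x ((L.tog δ).map L.core) with hβ
  have hβ1 : ∀ δ x, β δ x ≤ 1 := fun δ x => by
    rcases bond_eq_one_or x ((L.tog δ).map L.core) with h | h <;> simp only [hβ, h] <;> norm_num
  have hen : ∀ x, energy lam (L.graph Finset.univ) x =
      energy lam (L.graph A) x + lam * ∑ δ ∈ Aᶜ, β δ x := by
    intro x
    rw [energy_eq lam _ _ (L.edgeSet_graph _), energy_eq lam _ _ (L.edgeSet_graph _), ← mul_add]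
    congr 1
    have hU : L.edges Finset.univ = L.edges A ∪ Aᶜ.image fun δ => (L.tog δ).map L.core := by
      rw [edges, edges, Finset.union_right_comm, ← Finset.image_union, Finset.union_compl]
    rw [hU, Finset.sum_union, Finset.sum_image L.map_tog_inj.injOn]
    rw [Finset.disjoint_right]
    intro e he
    obtain ⟨δ, hδ, rfl⟩ := Finset.mem_image.1 he
    rw [map_tog_mem_edges]
    simpa using hδ
  set cst : ℝ := lam * (Aᶜ.card : ℝ) with hcst
  have hZ : partitionFn lam (L.graph Finset.univ) ≤
      partitionFn lam (L.graph A) * Real.exp cst := by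
    unfold partitionFn
    rw [Finset.sum_mul]
    refine Finset.sum_le_sum fun x _ => ?_
    rw [← Real.exp_add, hen x]
    refine Real.exp_le_exp.2 (add_le_add_right (mul_le_mul_of_nonneg_left ?_ hlam.le) _)
    calc ∑ δ ∈ Aᶜ, β δ x ≤ ∑ δ ∈ Aᶜ, (1 : ℝ) := Finset.sum_le_sum fun δ _ => hβ1 δ x
      _ = _ := by simp
  have hlogZ : Real.log (partitionFn lam (L.graph Finset.univ)) ≤
      Real.log (partitionFn lam (L.graph A)) + cst := by
    rw [← Real.log_exp cst, ← Real.log_mul (partitionFn_pos _ _).ne' (Real.exp_pos _).ne']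
    exact Real.log_le_log (partitionFn_pos _ _) hZ
  have hpt : ∀ x, Real.log (prob lam (L.graph A) x / prob lam (L.graph Finset.univ) x) ≤
      lam * ∑ δ ∈ Aᶜ, (1 - β δ x) := by
    intro x
    rw [Real.log_div (prob_pos _ _ _).ne' (prob_pos _ _ _).ne', prob, prob,
      Real.log_div (Real.exp_pos _).ne' (partitionFn_pos _ _).ne',
      Real.log_div (Real.exp_pos _).ne' (partitionFn_pos _ _).ne', Real.log_exp, Real.log_exp,
      hen x, Finset.sum_sub_distrib, mul_sub]
    simp only [Finset.sum_const, nsmul_eq_mul, mul_one]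
    linarith
  have hE : ∀ δ, ∑ x, prob lam (L.graph A) x * (1 - β δ x) ≤ 2 * B := by
    intro δ
    obtain ⟨i, j, hij⟩ : ∃ i j, L.tog δ = s(i, j) := ⟨_, _, (Quot.out_eq (L.tog δ)).symm⟩
    have h1 := h δ i j hij
    have : ∑ x, prob lam (L.graph A) x * (1 - β δ x) =
        2 * disagree lam (L.graph A) (L.core i) (L.core j) := by
      rw [disagree, Finset.mul_sum]
      refine Finset.sum_congr rfl fun x _ => ?_
      simp only [hβ, hij, Sym2.map_mk, bond_mk, spin_mul_spin_eq]
      split_ifs <;> ring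
    linarith
  calc relEntropy lam (L.graph A) (L.graph Finset.univ)
      ≤ ∑ x, prob lam (L.graph A) x * (lam * ∑ δ ∈ Aᶜ, (1 - β δ x)) :=
        Finset.sum_le_sum fun x _ => mul_le_mul_of_nonneg_left (hpt x) (prob_pos _ _ _).le
    _ = lam * ∑ δ ∈ Aᶜ, ∑ x, prob lam (L.graph A) x * (1 - β δ x) := by
        rw [Finset.sum_comm, Finset.mul_sum]
        refine Finset.sum_congr rfl fun x _ => ?_
        rw [← Finset.mul_sum]; ring
    _ ≤ lam * ∑ δ ∈ Aᶜ, 2 * B :=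
        mul_le_mul_of_nonneg_left (Finset.sum_le_sum fun δ _ => hE δ) hlam.le
    _ = Aᶜ.card * (2 * lam * B) := by
        rw [Finset.sum_const, nsmul_eq_mul]; ring
    _ ≤ _ := mul_le_mul_of_nonneg_right (by exact_mod_cast Finset.card_le_univ _) (by positivity)

/-- Volume of a ball of radius `q ≤ θ M` in the cube of all `2 ^ M` toggle states, by the
exponential Markov inequality with base `z = θ / (1 - θ)`. -/
lemma ball_le {θ : ℝ} (hθ : θ ∈ Set.Ioo (0 : ℝ) (1 / 2)) {q : ℕ}
    (hq : (q : ℝ) ≤ θ * Fintype.card Δ) (H : SimpleGraph (Fin p)) :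
    (∑ A : Finset Δ, if editDist (L.graph A) H ≤ q then (1 : ℝ) else 0) *
      Real.exp (Fintype.card Δ * (Real.log 2 - Real.binEntropy θ)) ≤
      Fintype.card (Finset Δ) := by
  classical
  obtain ⟨h0, h1⟩ := hθ
  have h1' : 0 < 1 - θ := by linarith
  set z := θ / (1 - θ) with hz
  have hz0 : 0 < z := div_pos h0 h1'
  have hz1 : z ≤ 1 := (div_le_one h1').2 (by linarith)
  set M := Fintype.card Δ with hM
  set B : Finset Δ := Finset.univ.filter fun δ => (L.tog δ).map L.core ∈ H.edgeSet with hB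
  have hsum : ∑ A : Finset Δ, z ^ (symmDiff A B).card = (1 + z) ^ M := by
    have hinv : Function.Involutive (fun A : Finset Δ => symmDiff A B) := fun A =>
      symmDiff_symmDiff_cancel_right _ _
    have e1 : ∑ A : Finset Δ, z ^ (symmDiff A B).card = ∑ A : Finset Δ, z ^ A.card :=
      Equiv.sum_comp (hinv.toPerm _) fun A : Finset Δ => z ^ A.card
    rw [e1]
    have := Fintype.sum_pow_mul_eq_add_pow Δ z 1
    simp only [one_pow, mul_one] at this
    rw [this, add_comm]
  have hle : (∑ A : Finset Δ, if editDist (L.graph A) H ≤ q then (1 : ℝ) else 0) ≤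
      (z ^ q)⁻¹ * (1 + z) ^ M := by
    rw [← hsum, Finset.mul_sum]
    refine Finset.sum_le_sum fun A _ => ?_
    split_ifs with h
    · have := (L.card_symmDiff_le_editDist H A B (by simp [hB])).trans h
      rw [inv_mul_eq_div, le_div_iff₀ (pow_pos hz0 _), one_mul]
      exact pow_le_pow_of_le_one hz0.le hz1 this
    · positivity
  refine (mul_le_mul_of_nonneg_right hle (Real.exp_pos _).le).trans ?_
  rw [Fintype.card_finset, ← hM]
  push_cast
  have hlz : Real.log z = Real.log θ - Real.log (1 - θ) := Real.log_div h0.ne' h1'.ne'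
  have hlz0 : Real.log z ≤ 0 := Real.log_nonpos hz0.le hz1
  have h1z : Real.log (1 + z) = -Real.log (1 - θ) := by
    rw [← Real.log_inv]
    congr 1
    rw [hz]
    field_simp
    ring
  have hH : Real.binEntropy θ = -θ * Real.log θ - (1 - θ) * Real.log (1 - θ) := by
    rw [Real.binEntropy, Real.log_inv, Real.log_inv]; ring
  refine (Real.log_le_log_iff (by positivity) (by positivity)).1 ?_
  rw [Real.log_mul (by positivity) (by positivity), Real.log_mul (by positivity) (by positivity),
    Real.log_inv, Real.log_pow, Real.log_pow, Real.log_pow, Real.log_exp, h1z, hH]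
  have h3 := mul_le_mul_of_nonneg_right hq (neg_nonneg.2 hlz0)
  rw [hlz] at h3 ⊢
  linarith

end Layout

/-! ### Random matchings -/

/-- `log cosh` exceeds its chord-type bound `lam * tanh lam / 2`: the derivatives compare because
`lam ≤ sinh lam * cosh lam`. -/
lemma mul_tanh_div_two_le_log_cosh {lam : ℝ} (h : 0 ≤ lam) :
    lam * Real.tanh lam / 2 ≤ Real.log (Real.cosh lam) := by
  have htd : ∀ x, HasDerivAt Real.tanh
      ((Real.cosh x * Real.cosh x - Real.sinh x * Real.sinh x) / Real.cosh x ^ 2) x := by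
    intro x
    have := (Real.hasDerivAt_sinh x).div (Real.hasDerivAt_cosh x) (Real.cosh_pos x).ne'
    refine this.congr_of_eventuallyEq (Filter.Eventually.of_forall fun y => ?_)
    exact Real.tanh_eq_sinh_div_cosh y
  have hd : ∀ x, HasDerivAt (fun x => Real.log (Real.cosh x) - x * Real.tanh x / 2)
      (Real.sinh x / Real.cosh x - (1 * Real.tanh x + x * ((Real.cosh x * Real.cosh x -
        Real.sinh x * Real.sinh x) / Real.cosh x ^ 2)) / 2) x := fun x =>
    ((Real.hasDerivAt_cosh x).log (Real.cosh_pos x).ne').sub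
      (((hasDerivAt_id x).mul (htd x)).div_const 2)
  have hmono : MonotoneOn (fun x => Real.log (Real.cosh x) - x * Real.tanh x / 2)
      (Set.Ici (0 : ℝ)) := by
    refine monotoneOn_of_deriv_nonneg (convex_Ici 0)
      (fun x _ => (hd x).continuousAt.continuousWithinAt)
      (fun x _ => (hd x).differentiableAt.differentiableWithinAt) fun x hx => ?_
    rw [interior_Ici, Set.mem_Ioi] at hx
    rw [(hd x).deriv, Real.tanh_eq_sinh_div_cosh]
    have hc := Real.cosh_pos x
    have h1 := Real.cosh_sq x
    have h2 : x ≤ Real.sinh x := Real.self_le_sinh_iff.2 hx.le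
    have h3 := Real.one_le_cosh x
    have e : Real.sinh x / Real.cosh x - (1 * (Real.sinh x / Real.cosh x) + x * ((Real.cosh x *
        Real.cosh x - Real.sinh x * Real.sinh x) / Real.cosh x ^ 2)) / 2 =
        (Real.sinh x * Real.cosh x - x) / (2 * Real.cosh x ^ 2) := by
      have h4 : Real.cosh x * Real.cosh x - Real.sinh x * Real.sinh x = 1 := by nlinarith
      rw [h4]
      field_simp
      ring
    rw [e]
    refine div_nonneg ?_ (by positivity)
    nlinarith
  have := hmono (Set.mem_Ici.2 le_rfl) (Set.mem_Ici.2 h) h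
  simp only [Real.cosh_zero, Real.log_one, zero_mul, zero_div, sub_zero] at this
  linarith

/-- A pendant edge has mean bond `t`, whatever the rest of the graph. -/
lemma sum_weight_mul_bond_pendant {V : Type*} [DecidableEq V] [Fintype V] {t : ℝ}
    {E : Finset (Sym2 V)} {y b : V} (hyb : b ≠ y) (he : s(y, b) ∈ E)
    (hE : ∀ e ∈ E, y ∈ e → e = s(y, b)) :
    ∑ x, weight t E x * bond x s(y, b) = t * ∑ x, weight t E x := by
  set g : (V → ℤˣ) → ℝ := weight t (E.erase s(y, b)) with hg
  have hgi : IndepOf y g := indepOf_weight fun e he' hy =>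
    (Finset.mem_erase.1 he').1 (hE e (Finset.mem_erase.1 he').2 hy)
  have hw : ∀ x, weight t E x = (1 + t * bond x s(y, b)) * g x := fun x =>
    (Finset.mul_prod_erase E (fun e => 1 + t * bond x e) he).symm
  have h0 : ∑ x, g x * bond x s(y, b) = 0 := by
    rw [← sum_mul_spin_eq_zero (hgi.mul (indepOf_spin hyb))]
    exact Finset.sum_congr rfl fun x _ => by rw [bond_mk]; ring
  have h1 : ∀ x : V → ℤˣ, bond x s(y, b) * bond x s(y, b) = 1 := fun x => by
    rcases bond_eq_one_or x s(y, b) with h | h <;> rw [h] <;> norm_num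
  have e1 : ∑ x, weight t E x * bond x s(y, b) =
      ∑ x, g x * bond x s(y, b) + t * ∑ x, g x := by
    rw [Finset.mul_sum, ← Finset.sum_add_distrib]
    exact Finset.sum_congr rfl fun x _ => by rw [hw]; linear_combination t * g x * h1 x
  have e2 : ∑ x, weight t E x = ∑ x, g x + t * ∑ x, g x * bond x s(y, b) := by
    rw [Finset.mul_sum, ← Finset.sum_add_distrib]
    exact Finset.sum_congr rfl fun x _ => by rw [hw]; ring
  rw [e1, e2, h0]; ring

section Matching

variable {p k : ℕ}

/-- The edge joining vertex `i` among the first `k` vertices to vertex `v` among the others. -/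
def crossEdge (h : k ≤ p) (i : Fin k) (v : Fin (p - k)) : Sym2 (Fin p) :=
  s(⟨i, by omega⟩, ⟨k + v, by omega⟩)

lemma crossEdge_inj (h : k ≤ p) {i i' : Fin k} {v v' : Fin (p - k)}
    (e : crossEdge h i v = crossEdge h i' v') : i = i' ∧ v = v' := by
  rcases Sym2.eq_iff.1 e with ⟨h1, h2⟩ | ⟨h1, h2⟩ <;> simp only [Fin.mk.injEq] at h1 h2
  · exact ⟨Fin.ext h1, Fin.ext (by omega)⟩
  · omega

/-- The edges of the matching that `f` describes. -/
def matchingEdges (h : k ≤ p) (f : Fin k → Fin (p - k)) : Finset (Sym2 (Fin p)) :=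
  Finset.univ.image fun i => crossEdge h i (f i)

/-- The graph in which each `i` among the first `k` vertices is joined to `f i` only. -/
def matching (h : k ≤ p) (f : Fin k → Fin (p - k)) : SimpleGraph (Fin p) :=
  SimpleGraph.fromEdgeSet (matchingEdges h f : Set (Sym2 (Fin p)))

lemma edgeSet_matching (h : k ≤ p) (f : Fin k → Fin (p - k)) :
    (matching h f).edgeSet = ↑(matchingEdges h f) := by
  rw [matching, SimpleGraph.edgeSet_fromEdgeSet, sdiff_eq_left, Set.disjoint_left]
  intro e he hd
  obtain ⟨i, _, rfl⟩ := Finset.mem_image.1 (Finset.mem_coe.1 he)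
  have := congrArg Fin.val (Sym2.mk_isDiag_iff.1 hd)
  simp only at this
  omega

lemma card_matchingEdges (h : k ≤ p) (f : Fin k → Fin (p - k)) :
    (matchingEdges h f).card = k := by
  rw [matchingEdges, Finset.card_image_of_injective, Finset.card_fin]
  exact fun i j e => (crossEdge_inj h e).1

lemma matching_mem_class (h : k ≤ p) (f : Fin k ↪ Fin (p - k)) {d η γ : ℕ} (hd : 1 ≤ d)
    (hη : 1 ≤ η) : matching h f ∈ sparseSeparatorClass p k d η γ := by
  have hdeg : ∀ x, ((matching h f).neighborSet x).ncard ≤ 1 := by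
    intro x
    rw [Set.ncard_le_one]
    intro y hy z hz
    rw [SimpleGraph.mem_neighborSet, ← SimpleGraph.mem_edgeSet, edgeSet_matching, Finset.mem_coe,
      matchingEdges, Finset.mem_image] at hy hz
    obtain ⟨i, _, hi⟩ := hy
    obtain ⟨j, _, hj⟩ := hz
    have hij : i = j := by
      rcases Sym2.eq_iff.1 hi with ⟨h1, h2⟩ | ⟨h1, h2⟩ <;>
        rcases Sym2.eq_iff.1 hj with ⟨h3, h4⟩ | ⟨h3, h4⟩
      · have := congrArg Fin.val (h1.trans h3.symm)
        exact Fin.ext this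
      · have := congrArg Fin.val (h1.trans h4.symm)
        simp only at this; omega
      · have := congrArg Fin.val (h2.trans h3.symm)
        simp only at this; omega
      · have := congrArg Fin.val (h2.trans h4.symm)
        exact f.injective (Fin.ext (by simp only at this; omega))
    subst hij
    exact Sym2.congr_right.1 (hi.symm.trans hj)
  refine ⟨?_, fun x => (hdeg x).trans hd, fun x y hxy hadj =>
    exists_separator_of_ncard_neighborSet_le γ hxy hadj ((hdeg x).trans hη)⟩
  rw [edgeSet_matching, Set.ncard_coe_finset, card_matchingEdges]

lemma relEntropy_matching_le (h : k ≤ p) (f : Fin k → Fin (p - k)) {lam : ℝ} (hlam : 0 < lam) :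
    relEntropy lam (matching h f) ⊥ ≤ k * (lam * Real.tanh lam / 2) := by
  set t := Real.tanh lam
  have ht : 0 ≤ t := (tanh_pos hlam).le
  set E := matchingEdges h f with hE
  have hset : (matching h f).edgeSet = ↑E := edgeSet_matching h f
  have hbot : (⊥ : SimpleGraph (Fin p)).edgeSet = ↑(∅ : Finset (Sym2 (Fin p))) := by simp
  have hW : 0 < ∑ x : Config p, weight t E x :=
    lt_of_lt_of_le (by positivity) (two_pow_le_sum_weight ht E)
  have hmean : ∀ e ∈ E, ∑ x, prob lam (matching h f) x * bond x e = t := by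
    intro e he
    obtain ⟨i, _, rfl⟩ := Finset.mem_image.1 he
    have := sum_weight_mul_bond_pendant (t := t) (E := E) (y := ⟨i, by omega⟩)
      (b := ⟨k + f i, by omega⟩) (by simp only [ne_eq, Fin.mk.injEq]; omega) he (by
        intro e' he' hy
        obtain ⟨j, _, rfl⟩ := Finset.mem_image.1 he'
        simp only [crossEdge, Sym2.mem_iff, Fin.mk.injEq] at hy
        have : i = j := Fin.ext (by omega)
        subst this
        rfl)
    simp only [prob_eq lam _ E hset, div_mul_eq_mul_div]
    rw [← Finset.sum_div, div_eq_iff hW.ne']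
    exact this
  have hZ : k * Real.log (Real.cosh lam) + p * Real.log 2 ≤
      Real.log (partitionFn lam (matching h f)) := by
    rw [partitionFn_eq lam _ E hset, card_matchingEdges,
      Real.log_mul (pow_pos (Real.cosh_pos _) _).ne' hW.ne', Real.log_pow]
    have := Real.log_le_log (by positivity) (two_pow_le_sum_weight (V := Fin p) ht E)
    rw [Real.log_pow, Fintype.card_fin] at this
    linarith
  have hZ0 : Real.log (partitionFn lam (⊥ : SimpleGraph (Fin p))) = p * Real.log 2 := by
    rw [partitionFn_eq lam _ ∅ hbot]
    simp [weight, Fintype.card_pi]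
  have hpt : ∀ x, Real.log (prob lam (matching h f) x / prob lam ⊥ x) ≤
      lam * ∑ e ∈ E, bond x e - k * Real.log (Real.cosh lam) := by
    intro x
    rw [Real.log_div (prob_pos _ _ _).ne' (prob_pos _ _ _).ne', prob, prob,
      Real.log_div (Real.exp_pos _).ne' (partitionFn_pos _ _).ne',
      Real.log_div (Real.exp_pos _).ne' (partitionFn_pos _ _).ne', Real.log_exp, Real.log_exp,
      energy_eq lam _ E hset, energy_eq lam _ ∅ hbot, hZ0, Finset.sum_empty]
    linarith
  have hsum : relEntropy lam (matching h f) ⊥ ≤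
      k * (lam * t) - k * Real.log (Real.cosh lam) := by
    calc relEntropy lam (matching h f) ⊥ ≤ ∑ x, prob lam (matching h f) x *
          (lam * ∑ e ∈ E, bond x e - k * Real.log (Real.cosh lam)) :=
          Finset.sum_le_sum fun x _ => mul_le_mul_of_nonneg_left (hpt x) (prob_pos _ _ _).le
      _ = lam * (∑ e ∈ E, ∑ x, prob lam (matching h f) x * bond x e) -
          (∑ x, prob lam (matching h f) x) * (k * Real.log (Real.cosh lam)) := by
          rw [Finset.sum_comm, Finset.mul_sum, Finset.sum_mul, ← Finset.sum_sub_distrib]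
          refine Finset.sum_congr rfl fun x _ => ?_
          rw [← Finset.mul_sum]; ring
      _ = _ := by
          rw [Finset.sum_congr rfl hmean, sum_prob, Finset.sum_const, card_matchingEdges,
            nsmul_eq_mul]
          ring
  have := mul_le_mul_of_nonneg_left (mul_tanh_div_two_le_log_cosh hlam.le)
    (Nat.cast_nonneg (α := ℝ) k)
  linarith

/-- Few matchings lie close to a given graph `H`: to stay within distance `q`, all but `q` of
the `k` edges must belong to `H`, and `H` has at most `2 k` edges. The count is an exponential
Markov inequality with base `p`. -/
lemma ball_matching_le (h : k ≤ p) (hk : 1 ≤ k) {q : ℕ} (hq : q ≤ k) (H : SimpleGraph (Fin p)) :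
    (∑ f : Fin k ↪ Fin (p - k), if editDist (matching h f) H ≤ q then (1 : ℝ) else 0) ≤
      (p : ℝ) ^ q * 4 ^ k := by
  classical
  have hp : (0 : ℝ) < p := by exact_mod_cast (show 0 < p by omega)
  have hp1 : (1 : ℝ) ≤ p := by exact_mod_cast (show 1 ≤ p by omega)
  by_cases hex : ∃ f : Fin k ↪ Fin (p - k), editDist (matching h f) H ≤ q
  swap
  · push Not at hex
    rw [Finset.sum_eq_zero fun f _ => if_neg (not_le.2 (hex f))]
    positivity
  have hHcard : H.edgeSet.ncard ≤ 2 * k := by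
    obtain ⟨f, hf⟩ := hex
    have hsub : H.edgeSet ⊆ (matching h f).edgeSet ∪
        symmDiff (matching h f).edgeSet H.edgeSet := by
      intro e he
      by_cases he' : e ∈ (matching h f).edgeSet
      · exact Or.inl he'
      · exact Or.inr (Or.inr ⟨he, he'⟩)
    have h1 := (Set.ncard_le_ncard hsub (Set.toFinite _)).trans (Set.ncard_union_le _ _)
    have h2 : (matching h f).edgeSet.ncard = k := by
      rw [edgeSet_matching, Set.ncard_coe_finset, card_matchingEdges]
    have h3 : (symmDiff (matching h f).edgeSet H.edgeSet).ncard ≤ q := hf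
    omega
  set D : Fin k → Finset (Fin (p - k)) := fun i =>
    Finset.univ.filter fun v => crossEdge h i v ∈ H.edgeSet with hD
  have hDsum : ∑ i, (D i).card ≤ 2 * k := by
    refine le_trans ?_ hHcard
    rw [← Finset.card_sigma, ← Finset.card_image_of_injOn
      (f := fun a : Σ _ : Fin k, Fin (p - k) => crossEdge h a.1 a.2), ← Set.ncard_coe_finset]
    · refine Set.ncard_le_ncard ?_ (Set.toFinite _)
      intro e he
      obtain ⟨a, ha, rfl⟩ := Finset.mem_image.1 (Finset.mem_coe.1 he)
      simpa [hD] using ha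
    · rintro ⟨i, v⟩ _ ⟨i', v'⟩ _ e
      obtain ⟨rfl, rfl⟩ := crossEdge_inj h e
      rfl
  set F : (Fin k → Fin (p - k)) → ℝ := fun f =>
    (p : ℝ) ^ q * ∏ i, (if f i ∈ D i then (1 : ℝ) else (p : ℝ)⁻¹) with hF
  have hF0 : ∀ f, 0 ≤ F f := fun f => mul_nonneg (by positivity)
    (Finset.prod_nonneg fun i _ => by split_ifs <;> positivity)
  have hle : ∀ f : Fin k ↪ Fin (p - k),
      (if editDist (matching h f) H ≤ q then (1 : ℝ) else 0) ≤ F f := by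
    intro f
    split_ifs with hf
    · set J : Finset (Fin k) := Finset.univ.filter fun i => f i ∉ D i with hJ
      have hJq : J.card ≤ q := by
        refine le_trans ?_ hf
        rw [editDist, ← Finset.card_image_of_injOn (f := fun i => crossEdge h i (f i)),
          ← Set.ncard_coe_finset]
        · refine Set.ncard_le_ncard ?_ (Set.toFinite _)
          intro e he
          obtain ⟨i, hi, rfl⟩ := Finset.mem_image.1 (Finset.mem_coe.1 he)
          refine Or.inl ⟨?_, by simpa [hJ, hD] using hi⟩
          rw [edgeSet_matching]
          exact Finset.mem_coe.2 (Finset.mem_image_of_mem _ (Finset.mem_univ _))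
        · exact fun i _ j _ e => (crossEdge_inj h e).1
      have hprod : ∏ i, (if f i ∈ D i then (1 : ℝ) else (p : ℝ)⁻¹) = ((p : ℝ) ^ J.card)⁻¹ := by
        rw [Finset.prod_ite, Finset.prod_const_one, one_mul, Finset.prod_const, inv_pow]
      rw [hF]
      simp only [hprod]
      rw [← div_eq_mul_inv, le_div_iff₀ (by positivity), one_mul]
      exact pow_le_pow_right₀ hp1 hJq
    · exact hF0 f
  have hprodsum : ∑ f : Fin k → Fin (p - k), F f =
      (p : ℝ) ^ q * ∏ i : Fin k, ∑ v, (if v ∈ D i then (1 : ℝ) else (p : ℝ)⁻¹) := by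
    rw [hF, ← Finset.mul_sum, Finset.prod_univ_sum, Fintype.piFinset_univ]
  have hfactor : ∀ i, ∑ v, (if v ∈ D i then (1 : ℝ) else (p : ℝ)⁻¹) ≤ 2 ^ (D i).card := by
    intro i
    have h1 : ∑ v, (if v ∈ D i then (1 : ℝ) else (p : ℝ)⁻¹) ≤
        ∑ v : Fin (p - k), ((if v ∈ D i then (1 : ℝ) else 0) + (p : ℝ)⁻¹) := by
      refine Finset.sum_le_sum fun v _ => ?_
      have : (0 : ℝ) ≤ (p : ℝ)⁻¹ := by positivity
      split_ifs <;> linarith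
    have h2 : ∑ v : Fin (p - k), ((if v ∈ D i then (1 : ℝ) else 0) + (p : ℝ)⁻¹) ≤
        (D i).card + 1 := by
      rw [Finset.sum_add_distrib, Finset.sum_const, Finset.card_fin, nsmul_eq_mul]
      refine add_le_add (by simp) ?_
      rw [← div_eq_mul_inv, div_le_one hp]
      exact_mod_cast Nat.sub_le p k
    have h3 : (D i).card + 1 ≤ 2 ^ (D i).card := Nat.lt_two_pow_self
    have h4 : ((D i).card : ℝ) + 1 ≤ 2 ^ (D i).card := by exact_mod_cast h3
    linarith
  calc (∑ f : Fin k ↪ Fin (p - k), if editDist (matching h f) H ≤ q then (1 : ℝ) else 0)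
      ≤ ∑ f : Fin k ↪ Fin (p - k), F f := Finset.sum_le_sum fun f _ => hle f
    _ = ∑ f ∈ Finset.univ.map ⟨fun f : Fin k ↪ Fin (p - k) => (f : Fin k → Fin (p - k)),
          DFunLike.coe_injective⟩, F f := by rw [Finset.sum_map]; rfl
    _ ≤ ∑ f : Fin k → Fin (p - k), F f :=
        Finset.sum_le_sum_of_subset_of_nonneg (Finset.subset_univ _) fun f _ _ => hF0 f
    _ = (p : ℝ) ^ q * ∏ i : Fin k, ∑ v, (if v ∈ D i then (1 : ℝ) else (p : ℝ)⁻¹) := hprodsum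
    _ ≤ (p : ℝ) ^ q * ∏ i : Fin k, 2 ^ (D i).card :=
        mul_le_mul_of_nonneg_left (Finset.prod_le_prod (fun i _ => Finset.sum_nonneg fun v _ => by
          split_ifs <;> positivity) fun i _ => hfactor i) (by positivity)
    _ ≤ (p : ℝ) ^ q * 4 ^ k := by
        refine mul_le_mul_of_nonneg_left ?_ (by positivity)
        rw [Finset.prod_pow_eq_pow_sum, show (4 : ℝ) = 2 ^ 2 by norm_num, ← pow_mul]
        exact pow_le_pow_right₀ one_le_two hDsum

/-- Fano's inequality for the family of all matchings between the first `k` vertices and the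
others. -/
lemma matching_bound (h4 : 4 * k ≤ p) (hk : 1 ≤ k) {q n d η γ : ℕ} (hq : q ≤ k) (hd : 1 ≤ d)
    (hη : 1 ≤ η) {lam δ : ℝ} (hlam : 0 < lam)
    {decoder : (Fin n → Config p) → SimpleGraph (Fin p)}
    (herr : errorProb lam (sparseSeparatorClass p k d η γ) decoder q ≤ δ)
    (hΛ : 0 ≤ ((k : ℝ) - q) * Real.log p - 3 * k * Real.log 2) :
    (1 - δ) * (((k : ℝ) - q) * Real.log p - 3 * k * Real.log 2) - Real.log 2 ≤
      n * (k * (lam * Real.tanh lam / 2)) := by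
  have h : k ≤ p := by omega
  have hp : (0 : ℝ) < p := by exact_mod_cast (show 0 < p by omega)
  have hcard : ((p : ℝ) / 2) ^ k ≤ Fintype.card (Fin k ↪ Fin (p - k)) := by
    rw [Fintype.card_embedding_eq, Fintype.card_fin, Fintype.card_fin]
    have h1 := Nat.pow_sub_le_descFactorial (p - k) k
    have h2 : (p : ℝ) / 2 ≤ ((p - k + 1 - k : ℕ) : ℝ) := by
      rw [div_le_iff₀ two_pos]
      exact_mod_cast (show p ≤ (p - k + 1 - k) * 2 by omega)
    calc ((p : ℝ) / 2) ^ k ≤ ((p - k + 1 - k : ℕ) : ℝ) ^ k :=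
          pow_le_pow_left₀ (by positivity) h2 k
      _ ≤ _ := by exact_mod_cast h1
  have : Nonempty (Fin k ↪ Fin (p - k)) := by
    rw [← Fintype.card_pos_iff]
    have : (0 : ℝ) < Fintype.card (Fin k ↪ Fin (p - k)) :=
      lt_of_lt_of_le (by positivity) hcard
    exact_mod_cast this
  refine fano herr (fun f : Fin k ↪ Fin (p - k) => matching h f)
    (fun f => matching_mem_class h f hd hη) ⊥ (fun f => relEntropy_matching_le h f hlam) hΛ
    fun H => ?_
  refine (mul_le_mul_of_nonneg_right (ball_matching_le h hk hq H) (Real.exp_pos _).le).trans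
    (le_trans (le_of_eq ?_) hcard)
  have e1 : Real.exp (((k : ℝ) - q) * Real.log p - 3 * k * Real.log 2) =
      (p : ℝ) ^ k / p ^ q / 8 ^ k := by
    rw [Real.exp_sub, sub_mul, Real.exp_sub, ← Real.log_pow, ← Real.log_pow,
      Real.exp_log (by positivity), Real.exp_log (by positivity)]
    congr 1
    rw [show 3 * (k : ℝ) = ((3 * k : ℕ) : ℝ) by push_cast; ring, ← Real.log_pow,
      Real.exp_log (by positivity), pow_mul]
    norm_num
  rw [e1, div_pow, show (8 : ℝ) = 4 * 2 by norm_num, mul_pow]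
  field_simp

end Matching

/-! ### Cyclic bands and cliques on a path -/

namespace Layout

variable {p : ℕ} {C T Δ : Type} [Fintype C] [Fintype T] [Fintype Δ]

/-- Path lengths for a link with `b` paths of length `2` and `m` paths of length `γ + 1`. -/
def pathLen (b m γ : ℕ) : Fin b ⊕ Fin m → ℕ := Sum.elim (fun _ => 2) (fun _ => γ + 1)

lemma two_le_pathLen {b m γ : ℕ} (hγ : 1 ≤ γ) (r : Fin b ⊕ Fin m) : 2 ≤ pathLen b m γ r := by
  rcases r with r | r <;> simp only [pathLen, Sum.elim_inl, Sum.elim_inr] <;> omega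

lemma nonempty_emb {b m γ : ℕ} (hp : Fintype.card C + Fintype.card T * (b + m * γ) ≤ p) :
    Nonempty ((C ⊕ (Σ a : T × (Fin b ⊕ Fin m), Fin (pathLen b m γ a.2 - 1))) ↪ Fin p) := by
  classical
  refine Function.Embedding.nonempty_of_card_le ?_
  rw [Fintype.card_sum, Fintype.card_sigma]
  simp only [Fintype.card_fin]
  rw [Fintype.sum_prod_type]
  simpa [pathLen, Fintype.sum_sum_type] using hp

/-- Fano's inequality for the family of all graphs of a layout in which the two ends of each toggle
have link distance at most `y`. -/
lemma fano_bound {b m : ℕ} (L : Layout p C T (Fin b ⊕ Fin m) Δ) {k d η γ a n q : ℕ} {θ lam δ y : ℝ}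
    (hlen : L.len = pathLen b m γ) (ha : ∀ u, (L.togNbrs u).ncard ≤ a) (hη : a + b ≤ η)
    (hη2 : 2 ≤ η) (hd : a + 2 * (b + m) ≤ d) (hd2 : 2 ≤ d)
    (hk : Fintype.card Δ + Fintype.card T * (2 * b + m * (γ + 1)) ≤ k)
    (hθ : θ ∈ Set.Ioo (0 : ℝ) (1 / 2)) (hq : (q : ℝ) ≤ θ * Fintype.card Δ)
    (hy : 0 ≤ y)
    (hchain : ∀ δ, ∃ (c : ℕ → C) (s : ℕ), L.tog δ = s(c 0, c s) ∧ (s : ℝ) ≤ y ∧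
      ∀ l < s, ∃ τ, s(c l, c (l + 1)) = s(L.src τ, L.tgt τ))
    (hh : 0 ≤ Real.log 2 - Real.binEntropy θ) (hlam : 0 < lam)
    {decoder : (Fin n → Config p) → SimpleGraph (Fin p)}
    (herr : errorProb lam (sparseSeparatorClass p k d η γ) decoder q ≤ δ) :
    (1 - δ) * (Fintype.card Δ * (Real.log 2 - Real.binEntropy θ)) - Real.log 2 ≤
      n * (Fintype.card Δ * (2 * lam * (y / (1 +
        ((1 + Real.tanh lam ^ 2) / (1 - Real.tanh lam ^ 2)) ^ b *
        ((1 + Real.tanh lam ^ (γ + 1)) / (1 - Real.tanh lam ^ (γ + 1))) ^ m)))) := by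
  classical
  have hodds : L.odds (Real.tanh lam) = ((1 + Real.tanh lam ^ 2) / (1 - Real.tanh lam ^ 2)) ^ b *
        ((1 + Real.tanh lam ^ (γ + 1)) / (1 - Real.tanh lam ^ (γ + 1))) ^ m := by
    rw [odds, hlen, Fintype.prod_sum_type]
    simp [pathLen, div_pow]
  rw [← hodds]
  have hR : 0 ≤ L.odds (Real.tanh lam) :=
    L.odds_nonneg (tanh_pos hlam).le (Real.tanh_lt_one lam).le
  refine fano herr L.graph (fun A => L.graph_mem_class A (a := a)
    (Finset.univ.map Function.Embedding.inl) ?_ ?_ ha (by simpa using hη) hη2 (by simpa using hd)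
    hd2 ?_) (L.graph Finset.univ) (fun A => L.relEntropy_le hlam A (by positivity) ?_)
    (mul_nonneg (Nat.cast_nonneg _) hh) (L.ball_le hθ hq)
  · intro r hr
    obtain ⟨i, _, rfl⟩ := Finset.mem_map.1 hr
    simp [hlen, pathLen]
  · rintro (i | i) hr
    · simp at hr
    · simp [hlen, pathLen]
  · rw [hlen, Fintype.sum_sum_type]
    simpa [pathLen, mul_comm b 2] using hk
  · intro δ i j hij
    obtain ⟨c, s, h1, h2, h3⟩ := hchain δ
    have h4 : disagree lam (L.graph A) (L.core (c 0)) (L.core (c s)) ≤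
        y / (1 + L.odds (Real.tanh lam)) :=
      (L.disagree_chain_le hlam A c s h3).trans (div_le_div_of_nonneg_right h2 (by linarith))
    rw [h1] at hij
    rcases Sym2.eq_iff.1 hij with ⟨h, h'⟩ | ⟨h, h'⟩
    · rw [← h, ← h']; exact h4
    · rw [← h, ← h', disagree_comm]; exact h4

end Layout

lemma zmod_natCast_ne_zero {N s : ℕ} (h0 : 0 < s) (h1 : s < N) : (s : ZMod N) ≠ 0 := by
  rw [Ne, ZMod.natCast_eq_zero_iff]
  exact fun h => absurd (Nat.le_of_dvd h0 h) (by omega)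

/-- The edge of a cyclic band from `i` to the core `s + 1` steps further. -/
def bandEdge {N W : ℕ} (a : ZMod N × Fin W) : Sym2 (ZMod N) :=
  s(a.1, a.1 + ((a.2 : ℕ) + 1 : ℕ))

lemma bandEdge_injective {N W : ℕ} (h : 2 * W + 1 ≤ N) :
    Function.Injective (bandEdge (N := N) (W := W)) := by
  rintro ⟨i, s⟩ ⟨i', s'⟩ e
  rcases Sym2.eq_iff.1 e with ⟨h1, h2⟩ | ⟨h1, h2⟩ <;> simp only at h1 h2
  · subst h1
    have h3 := add_left_cancel h2
    rw [ZMod.natCast_eq_natCast_iff', Nat.mod_eq_of_lt (by omega), Nat.mod_eq_of_lt (by omega)]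
      at h3
    have : s = s' := Fin.ext (by omega)
    rw [this]
  · exfalso
    rw [h1, add_assoc, add_eq_left, ← Nat.cast_add] at h2
    exact zmod_natCast_ne_zero (by omega) (by omega) h2

/-- A cyclic chain of `N` cores in which the toggles join all pairs at cyclic distance at
most `W`. -/
def bandLayout {p N W b m γ : ℕ} (h : 2 * W + 1 ≤ N) (hW : 1 ≤ W) (hγ : 1 ≤ γ)
    (emb : (ZMod N ⊕ (Σ a : ZMod N × (Fin b ⊕ Fin m), Fin (Layout.pathLen b m γ a.2 - 1))) ↪
      Fin p) :
    Layout p (ZMod N) (ZMod N) (Fin b ⊕ Fin m) (ZMod N × Fin W) where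
  src i := i
  tgt i := i + 1
  len := Layout.pathLen b m γ
  tog := bandEdge
  emb := emb
  two_le_len := Layout.two_le_pathLen hγ
  src_inj := fun _ _ h => h
  tgt_inj := fun _ _ h => add_right_cancel h
  src_ne_tgt := fun i e => zmod_natCast_ne_zero (N := N) one_pos (by omega)
    (by simpa using e)
  link_inj := fun i j e => by
    have : bandEdge (i, (⟨0, hW⟩ : Fin W)) = bandEdge (j, (⟨0, hW⟩ : Fin W)) := by
      simpa [bandEdge] using e
    exact (Prod.mk.inj (bandEdge_injective h this)).1
  tog_inj := bandEdge_injective h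
  tog_not_isDiag := by
    rintro ⟨i, s⟩ e
    have := Sym2.mk_isDiag_iff.1 e
    exact zmod_natCast_ne_zero (N := N) (Nat.succ_pos s) (by omega) (by simpa using this)
  link_tog := fun i => ⟨(i, ⟨0, hW⟩), by simp [bandEdge]⟩

lemma band_bound {p N W b m γ k d η a n q : ℕ} {θ lam δ y : ℝ} (h : 2 * W + 1 ≤ N) (hW : 1 ≤ W)
    (hγ : 1 ≤ γ) (hp : N + N * (b + m * γ) ≤ p) (ha : 2 * W ≤ a) (hη : a + b ≤ η)
    (hη2 : 2 ≤ η) (hd : a + 2 * (b + m) ≤ d) (hd2 : 2 ≤ d)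
    (hk : N * W + N * (2 * b + m * (γ + 1)) ≤ k)
    (hθ : θ ∈ Set.Ioo (0 : ℝ) (1 / 2)) (hq : (q : ℝ) ≤ θ * (N * W : ℕ))
    (hy : (W : ℝ) ≤ y) (hh : 0 ≤ Real.log 2 - Real.binEntropy θ) (hlam : 0 < lam)
    {decoder : (Fin n → Config p) → SimpleGraph (Fin p)}
    (herr : errorProb lam (sparseSeparatorClass p k d η γ) decoder q ≤ δ) :
    (1 - δ) * ((N * W : ℕ) * (Real.log 2 - Real.binEntropy θ)) - Real.log 2 ≤
      n * ((N * W : ℕ) * (2 * lam * (y / (1 +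
        ((1 + Real.tanh lam ^ 2) / (1 - Real.tanh lam ^ 2)) ^ b *
        ((1 + Real.tanh lam ^ (γ + 1)) / (1 - Real.tanh lam ^ (γ + 1))) ^ m)))) := by
  have : NeZero N := ⟨by omega⟩
  obtain ⟨emb⟩ := Layout.nonempty_emb (p := p) (C := ZMod N) (T := ZMod N) (b := b) (m := m)
    (γ := γ) (by simpa [ZMod.card] using hp)
  have hcard : Fintype.card (ZMod N × Fin W) = N * W := by simp [ZMod.card]
  rw [← hcard] at hq hk ⊢
  refine (bandLayout h hW hγ emb).fano_bound (a := a) rfl ?_ hη hη2 hd hd2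
    (by rwa [ZMod.card]) hθ hq ((Nat.cast_nonneg W).trans hy) ?_ hh hlam herr
  · intro u
    have hsub : (bandLayout h hW hγ emb).togNbrs u ⊆
        ((fun s : Fin W => u + (((s : ℕ) + 1 : ℕ) : ZMod N)) '' Set.univ) ∪
        ((fun s : Fin W => u - (((s : ℕ) + 1 : ℕ) : ZMod N)) '' Set.univ) := by
      rintro c ⟨⟨i, s⟩, e⟩
      rcases Sym2.eq_iff.1 (show s(i, i + (((s : ℕ) + 1 : ℕ) : ZMod N)) = s(u, c) from e)
        with ⟨h1, h2⟩ | ⟨h1, h2⟩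
      · exact Or.inl ⟨s, trivial, by rw [← h1, ← h2]⟩
      · exact Or.inr ⟨s, trivial, by rw [← h1, ← h2]; simp⟩
    have hc : ∀ f : Fin W → ZMod N, (f '' Set.univ).ncard ≤ W := fun f =>
      (Set.ncard_image_le Set.finite_univ).trans (by simp)
    have h1 := (Set.ncard_le_ncard hsub (Set.toFinite _)).trans (Set.ncard_union_le _ _)
    have h2 := hc fun s : Fin W => u + (((s : ℕ) + 1 : ℕ) : ZMod N)
    have h3 := hc fun s : Fin W => u - (((s : ℕ) + 1 : ℕ) : ZMod N)
    omega
  · rintro ⟨i, s⟩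
    refine ⟨fun l => i + (l : ZMod N), s + 1, ?_, ?_, fun l _ => ⟨i + (l : ZMod N), ?_⟩⟩
    · simp [bandLayout, bandEdge]
    · refine le_trans ?_ hy
      exact_mod_cast s.2
    · simp [bandLayout, add_assoc]

/-- A chain of `a + 1` cores in which the toggles join all pairs. -/
def cliqueLayout {p a b m γ : ℕ} (hγ : 1 ≤ γ)
    (emb : (Fin (a + 1) ⊕ (Σ e : Fin a × (Fin b ⊕ Fin m), Fin (Layout.pathLen b m γ e.2 - 1))) ↪
      Fin p) :
    Layout p (Fin (a + 1)) (Fin a) (Fin b ⊕ Fin m) {e : Sym2 (Fin (a + 1)) // ¬ e.IsDiag} where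
  src := Fin.castSucc
  tgt := Fin.succ
  len := Layout.pathLen b m γ
  tog := Subtype.val
  emb := emb
  two_le_len := Layout.two_le_pathLen hγ
  src_inj := Fin.castSucc_injective _
  tgt_inj := Fin.succ_injective _
  src_ne_tgt := fun i => Fin.castSucc_lt_succ.ne
  link_inj := fun i j e => by
    rcases Sym2.eq_iff.1 e with ⟨h1, _⟩ | ⟨h1, h2⟩
    · exact Fin.castSucc_injective _ h1
    · have := congrArg Fin.val h1
      have := congrArg Fin.val h2
      simp only [Fin.val_castSucc, Fin.val_succ] at *
      omega
  tog_inj := Subtype.val_injective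
  tog_not_isDiag := Subtype.property
  link_tog := fun i => ⟨⟨s(i.castSucc, i.succ), by
    rw [Sym2.mk_isDiag_iff]; exact Fin.castSucc_lt_succ.ne⟩, rfl⟩

lemma clique_bound {p a b m γ k d η n q : ℕ} {θ lam δ y : ℝ}
    (hγ : 1 ≤ γ) (hp : (a + 1) + a * (b + m * γ) ≤ p) (hη : (a + 1) + b ≤ η)
    (hη2 : 2 ≤ η) (hd : (a + 1) + 2 * (b + m) ≤ d) (hd2 : 2 ≤ d)
    (hk : (a + 1).choose 2 + a * (2 * b + m * (γ + 1)) ≤ k)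
    (hθ : θ ∈ Set.Ioo (0 : ℝ) (1 / 2)) (hq : (q : ℝ) ≤ θ * ((a + 1).choose 2 : ℕ))
    (hy : (a : ℝ) ≤ y) (hh : 0 ≤ Real.log 2 - Real.binEntropy θ) (hlam : 0 < lam)
    {decoder : (Fin n → Config p) → SimpleGraph (Fin p)}
    (herr : errorProb lam (sparseSeparatorClass p k d η γ) decoder q ≤ δ) :
    (1 - δ) * (((a + 1).choose 2 : ℕ) * (Real.log 2 - Real.binEntropy θ)) - Real.log 2 ≤
      n * (((a + 1).choose 2 : ℕ) * (2 * lam * (y / (1 +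
        ((1 + Real.tanh lam ^ 2) / (1 - Real.tanh lam ^ 2)) ^ b *
        ((1 + Real.tanh lam ^ (γ + 1)) / (1 - Real.tanh lam ^ (γ + 1))) ^ m)))) := by
  obtain ⟨emb⟩ := Layout.nonempty_emb (p := p) (C := Fin (a + 1)) (T := Fin a) (b := b) (m := m)
    (γ := γ) (by simpa using hp)
  have hcard : Fintype.card {e : Sym2 (Fin (a + 1)) // ¬ e.IsDiag} = (a + 1).choose 2 := by
    rw [Sym2.card_subtype_not_diag, Fintype.card_fin]
  rw [← hcard] at hq hk ⊢
  refine (cliqueLayout hγ emb).fano_bound (a := a + 1) rfl ?_ hη hη2 hd hd2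
    (by rwa [Fintype.card_fin]) hθ hq ((Nat.cast_nonneg a).trans hy) ?_ hh hlam herr
  · intro u
    refine (Set.ncard_le_ncard (Set.subset_univ _) (Set.toFinite _)).trans ?_
    simp
  · have main : ∀ i j : Fin (a + 1), i ≤ j → ∃ (c : ℕ → Fin (a + 1)) (s : ℕ),
        s(i, j) = s(c 0, c s) ∧ (s : ℝ) ≤ y ∧
        ∀ l < s, ∃ τ : Fin a, s(c l, c (l + 1)) = s(τ.castSucc, τ.succ) := by
      intro i j hij
      have hij' : (i : ℕ) ≤ j := hij
      refine ⟨fun l => ⟨min (i + l) a, by omega⟩, j - i, ?_, ?_, ?_⟩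
      · congr 2
        · ext; simp only; omega
        · ext; simp only; omega
      · refine le_trans ?_ hy
        exact_mod_cast (show (j : ℕ) - i ≤ a by omega)
      · intro l hl
        refine ⟨⟨i + l, by omega⟩, ?_⟩
        congr 2
        · ext; simp only [Fin.val_castSucc]; omega
        · ext; simp only [Fin.val_succ]; omega
    rintro ⟨e, he⟩
    induction e with | _ i j =>
    rcases le_total i j with hij | hij
    · exact main i j hij
    · obtain ⟨c, s, h1, h2⟩ := main j i hij
      exact ⟨c, s, Sym2.eq_swap.trans h1, h2⟩

/-! ### Choice of parameters -/

set_option maxHeartbeats 1000000 in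
/-- In each of the two regimes there is a family with `M` free toggles, where `M` is at least the
quantity in `distortion` and at least a third of `sizeParam`. With `a = ⌈c η⌉` and `W = ⌊a / 2⌋`, a
cyclic band of half-width `W` is used when it has room for `2 W + 1` cores, and a single clique on
`a` cores otherwise. -/
lemma exists_toggle_family {p k d η γ m n : ℕ} {θ c lam δ : ℝ}
    {decoder : (Fin n → Config p) → SimpleGraph (Fin p)}
    (hθ : θ ∈ Set.Ioo (0 : ℝ) (1 / 2)) (hh : 0 ≤ Real.log 2 - Real.binEntropy θ)
    (h4 : 4 * k ≤ p) (hη1 : 1 ≤ η) (hηd : η ≤ d / 2) (hγ : 1 ≤ γ) (hm : m ≤ d / 2 - η)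
    (hc0 : 1 / (η : ℝ) < c) (hc1 : c ≤ 1) (hlam : 0 < lam)
    (herr : errorProb lam (sparseSeparatorClass p k d η γ) decoder
      (distortion θ c k η γ m) ≤ δ) (hN : 1 ≤ sizeParam c k η γ m) :
    ∃ M : ℕ, (sizeParam c k η γ m : ℝ) ≤ 3 * M ∧
      (1 - δ) * (M * (Real.log 2 - Real.binEntropy θ)) - Real.log 2 ≤
      n * (M * (2 * lam * (c * η / (1 +
        ((1 + Real.tanh lam ^ 2) / (1 - Real.tanh lam ^ 2)) ^ (η - ⌈c * η⌉₊) *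
        ((1 + Real.tanh lam ^ (γ + 1)) / (1 - Real.tanh lam ^ (γ + 1))) ^ m)))) := by
  have hη0 : (0 : ℝ) < η := by exact_mod_cast hη1
  have hx1 : 1 < c * η := (div_lt_iff₀ hη0).1 hc0
  have hxη : c * η ≤ η := by nlinarith
  have hqle : (distortion θ c k η γ m : ℝ) ≤
      θ * ((c * η - 1) ^ 2 * k / (2 * (c * η) * (2 * η + m * (γ + 1)))) := by
    have : 0 < c := by
      by_contra h
      nlinarith
    unfold distortion
    rw [mul_assoc 2 c (η : ℝ)]
    exact Nat.floor_le (mul_nonneg hθ.1.le (by positivity))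
  set q := distortion θ c k η γ m
  unfold sizeParam at hN ⊢
  have e1 : 2 * (1 - c) * (η : ℝ) = 2 * (η - c * η) := by ring
  rw [e1] at hN ⊢
  set x : ℝ := c * η with hx
  have hxa : x ≤ (⌈x⌉₊ : ℝ) := Nat.le_ceil x
  have hax : (⌈x⌉₊ : ℝ) < x + 1 := Nat.ceil_lt_add_one (by linarith)
  have haη : ⌈x⌉₊ ≤ η := Nat.ceil_le.2 hxη
  have ha2 : 2 ≤ ⌈x⌉₊ := by
    have : (1 : ℝ) < (⌈x⌉₊ : ℝ) := by linarith
    exact_mod_cast this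
  set a := ⌈x⌉₊
  obtain ⟨b, hb⟩ : ∃ b, η = a + b := ⟨η - a, by omega⟩
  have hba : η - a = b := by omega
  rw [hba]
  have hηR : (η : ℝ) = a + b := by rw [hb]; push_cast; ring
  set W := a / 2 with hW
  have hW1 : 1 ≤ W := by omega
  have hWR1 : (2 : ℝ) * W ≤ a := by exact_mod_cast (show 2 * W ≤ a by omega)
  have hWR2 : (a : ℝ) ≤ 2 * W + 1 := by exact_mod_cast (show a ≤ 2 * W + 1 by omega)
  have hWR0 : (1 : ℝ) ≤ W := by exact_mod_cast hW1
  have haR2 : (2 : ℝ) ≤ a := by exact_mod_cast ha2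
  set w := W + 2 * b + m * (γ + 1) with hw
  set Y : ℝ := m * (γ + 1) with hY
  have hY0 : 0 ≤ Y := by positivity
  have hb0 : (0 : ℝ) ≤ b := Nat.cast_nonneg b
  have hwR : (w : ℝ) = W + 2 * b + Y := by rw [hw, hY]; push_cast; ring
  have hwpos : 0 < (w : ℝ) := by rw [hwR]; linarith
  set K₀ : ℝ := x * (x / 2 + 2 * (η - x) + Y) with hK₀
  have hw1 : (w : ℝ) ≤ x / 2 + 2 * (η - x) + Y := by rw [hwR]; linarith
  have hw2 : (w : ℝ) ≤ 2 * η + Y := by rw [hwR]; linarith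
  have hK₀pos : 0 < K₀ := mul_pos (by linarith) (by linarith)
  have hxw : x * w ≤ K₀ := mul_le_mul_of_nonneg_left hw1 (by linarith)
  have hfl : 1 ≤ ⌊(k : ℝ) / K₀⌋₊ := by
    by_contra h
    have h0 : ⌊(k : ℝ) / K₀⌋₊ = 0 := by omega
    rw [h0, zero_mul] at hN
    omega
  have hkK : K₀ ≤ k := by
    have := (Nat.le_floor_iff (by positivity)).1 hfl
    rw [Nat.cast_one, le_div_iff₀ hK₀pos] at this
    linarith
  have hch : (a.choose 2 : ℝ) = a * (a - 1) / 2 := Nat.cast_choose_two ℝ a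
  -- Each core costs at most `w` edges: `W` toggles and one link. The next two bounds control the
  -- size parameter and the distortion when the budget `k` pays for at most `K` such cores.
  have hsize : ∀ K : ℝ, (k : ℝ) ≤ K * w → (⌊(k : ℝ) / K₀⌋₊ : ℝ) ≤ K / x := by
    intro K hK
    refine (Nat.floor_le (by positivity)).trans ?_
    rw [div_le_div_iff₀ hK₀pos (by linarith)]
    have hK0 : 0 ≤ K := nonneg_of_mul_nonneg_left ((Nat.cast_nonneg k).trans hK) hwpos
    calc (k : ℝ) * x ≤ K * w * x := mul_le_mul_of_nonneg_right hK (by linarith)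
      _ = K * (x * w) := by ring
      _ ≤ K * K₀ := mul_le_mul_of_nonneg_left hxw hK0
  have htgt : ∀ K : ℝ, (k : ℝ) ≤ K * w →
      (x - 1) ^ 2 * k / (2 * x * (2 * η + Y)) ≤ (x - 1) ^ 2 * K / (2 * x) := by
    intro K hK
    have hK0 : 0 ≤ K := nonneg_of_mul_nonneg_left ((Nat.cast_nonneg k).trans hK) hwpos
    have hd1 : 0 < 2 * (η : ℝ) + Y := by linarith
    have hd2 : 0 < 2 * x := by linarith
    rw [← mul_div_mul_right ((x - 1) ^ 2 * K) (2 * x) hd1.ne', mul_assoc _ K]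
    exact div_le_div_of_nonneg_right (mul_le_mul_of_nonneg_left
      (hK.trans (mul_le_mul_of_nonneg_left hw2 hK0)) (sq_nonneg _)) (mul_pos hd2 hd1).le
  -- With at least `2 W + 1` cores the cyclic band is used.
  by_cases hcase : (2 * W + 1) * w ≤ k
  · set N := k / w with hNdef
    have hwN : 0 < w := by exact_mod_cast hwpos
    have hN1 : 2 * W + 1 ≤ N := (Nat.le_div_iff_mul_le hwN).2 hcase
    have hNk : N * w ≤ k := Nat.div_mul_le_self k w
    have hkN : (k : ℝ) ≤ ((N : ℝ) + 1) * w := by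
      have h1 : k < (k / w + 1) * w := by
        rw [mul_comm]; exact Nat.lt_mul_div_succ k hwN
      exact_mod_cast h1.le
    have hNx : x ≤ N := by
      have : (2 * (W : ℝ) + 1) ≤ N := by exact_mod_cast hN1
      linarith
    have hN3 : (3 : ℝ) ≤ N := by exact_mod_cast (show 3 ≤ N by omega)
    refine ⟨N * W, ?_, ?_⟩
    · have h1 := hsize _ hkN
      push_cast
      rw [hch]
      have h2 : ((N : ℝ) + 1) / x * (a * (a - 1) / 2) ≤ ((N : ℝ) + 1) * a / 2 := by
        rw [div_mul_eq_mul_div, div_le_div_iff₀ (by linarith) two_pos]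
        have h3 : (a : ℝ) - 1 ≤ x := by linarith
        have h4 := mul_le_mul_of_nonneg_left h3
          (show 0 ≤ ((N : ℝ) + 1) * a by positivity)
        linarith
      have h5 := mul_le_mul_of_nonneg_right h1
        (show (0 : ℝ) ≤ a * (a - 1) / 2 by
          have : (0 : ℝ) ≤ a - 1 := by linarith
          positivity)
      have h6 : ((N : ℝ) + 1) * a / 2 ≤ 3 * (N * W) := by
        have : ((N : ℝ) + 1) * a ≤ (2 * N) * (3 * W) :=
          mul_le_mul (by linarith) (by linarith) (by linarith) (by linarith)
        linarith
      linarith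
    · refine band_bound hN1 hW1 hγ ?_ (a := a) (by omega) (by omega) (by omega) (by omega)
        (by omega) ?_ hθ ?_ ?_ hh hlam herr
      · have h1 : N ≤ k := le_trans (Nat.le_mul_of_pos_right N hwN) hNk
        have h2 : N * (b + m * γ) ≤ N * w := Nat.mul_le_mul_left N (by rw [hw, Nat.mul_succ]; omega)
        omega
      · refine le_trans (le_of_eq ?_) hNk
        rw [hw]; ring
      · refine hqle.trans (mul_le_mul_of_nonneg_left ((htgt _ hkN).trans ?_) hθ.1.le)
        rw [div_le_iff₀ (by linarith)]
        push_cast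
        have h1 : (x - 1) * ((N : ℝ) + 1) ≤ x * N := by linarith
        have h2 : x - 1 ≤ 2 * W := by linarith
        have h3 := mul_le_mul h2 h1 (mul_nonneg (by linarith) (by linarith)) (by linarith)
        linarith
      · linarith
  · push Not at hcase
    have hkN : (k : ℝ) ≤ (2 * (W : ℝ) + 1) * w := by exact_mod_cast hcase.le
    obtain ⟨a', ha'⟩ : ∃ a', a = a' + 1 := ⟨a - 1, by omega⟩
    have haR' : (a : ℝ) = a' + 1 := by rw [ha']; push_cast; ring
    have hk' : a.choose 2 + a' * (2 * b + m * (γ + 1)) ≤ k := by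
      have h1 : ((a.choose 2 : ℕ) : ℝ) + a' * (2 * b + Y) ≤ k := by
        refine le_trans ?_ hkK
        rw [hch]
        have h2 : (a : ℝ) * (a - 1) / 2 + a' * (2 * b + Y) = (a - 1) * (a / 2 + 2 * b + Y) := by
          rw [haR']; ring
        rw [h2]
        exact mul_le_mul (by linarith) (by linarith) (by positivity) (by linarith)
      rw [hY] at h1
      exact_mod_cast h1
    refine ⟨a.choose 2, ?_, ?_⟩
    · rw [Nat.cast_mul]
      refine mul_le_mul_of_nonneg_right ?_ (Nat.cast_nonneg _)
      refine (hsize _ hkN).trans ?_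
      rw [div_le_iff₀ (by linarith)]
      linarith
    · rw [ha'] at hk' ⊢
      refine clique_bound hγ ?_ (η := η) (by omega) (by omega) (by omega) (by omega)
        hk' hθ ?_ ?_ hh hlam herr
      · have h1 : a' ≤ (a' + 1).choose 2 := by
          rw [Nat.choose_succ_succ' a' 1, Nat.choose_one_right]
          omega
        have h2 : a' * (b + m * γ) ≤ a' * (2 * b + m * (γ + 1)) :=
          Nat.mul_le_mul_left a' (by rw [Nat.mul_succ]; omega)
        omega
      · rw [← ha', hch]
        refine hqle.trans (mul_le_mul_of_nonneg_left ((htgt _ hkN).trans ?_) hθ.1.le)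
        rw [div_le_iff₀ (by linarith)]
        have h1 : (x - 1) * (2 * (W : ℝ) + 1) ≤ x * a :=
          calc (x - 1) * (2 * (W : ℝ) + 1) ≤ (x - 1) * (a + 1) :=
                mul_le_mul_of_nonneg_left (by linarith) (by linarith)
            _ ≤ x * a := by linarith
        have h2 : x - 1 ≤ a - 1 := by linarith
        have h3 := mul_le_mul h2 h1 (mul_nonneg (by linarith) (by linarith)) (by linarith)
        linarith
      · linarith

lemma one_add_tanh_sq_div (lam : ℝ) :
    (1 + Real.tanh lam ^ 2) / (1 - Real.tanh lam ^ 2) = Real.cosh (2 * lam) := by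
  have hc := (Real.cosh_pos lam).ne'
  have h1 := Real.cosh_sq lam
  rw [Real.cosh_two_mul, Real.tanh_eq_sinh_div_cosh]
  have h2 : 1 - (Real.sinh lam / Real.cosh lam) ^ 2 = 1 / Real.cosh lam ^ 2 := by
    field_simp
    linarith
  rw [h2]
  field_simp

lemma binEntropy_lt_log_two_of_mem {θ : ℝ} (hθ : θ ∈ Set.Ioo (0 : ℝ) (1 / 2)) :
    0 < Real.log 2 - Real.binEntropy θ := by
  have := Real.binEntropy_lt_log_two.2 (show θ ≠ 2⁻¹ by
    have := hθ.2
    rw [one_div] at this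
    exact this.ne)
  linarith

/-- The distortion never exceeds half the number of edges. -/
lemma distortion_le {θ c : ℝ} {k η γ m : ℕ} (hθ : θ ∈ Set.Ioo (0 : ℝ) (1 / 2)) (hη1 : 1 ≤ η)
    (hc0 : 1 / (η : ℝ) < c) (hc1 : c ≤ 1) : (distortion θ c k η γ m : ℝ) ≤ k / 2 := by
  have hη0 : (0 : ℝ) < η := by exact_mod_cast hη1
  have hx1 : 1 < c * η := (div_lt_iff₀ hη0).1 hc0
  have hxη : c * η ≤ η := by nlinarith
  have hY : (0 : ℝ) ≤ m * (γ + 1) := by positivity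
  have hk : (0 : ℝ) ≤ k := Nat.cast_nonneg k
  unfold distortion
  rw [mul_assoc 2 c (η : ℝ)]
  set x := c * (η : ℝ)
  have hnn : 0 ≤ (x - 1) ^ 2 * k / (2 * x * (2 * η + m * (γ + 1))) := by positivity
  refine (Nat.floor_le (mul_nonneg hθ.1.le hnn)).trans ?_
  have h1 : (x - 1) ^ 2 * k / (2 * x * (2 * η + m * (γ + 1))) ≤ k := by
    rw [div_le_iff₀ (by positivity), mul_comm]
    refine mul_le_mul_of_nonneg_left ?_ hk
    nlinarith
  have h2 := mul_le_mul hθ.2.le h1 hnn (by norm_num)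
  linarith

/-- The size parameter counts edges that a graph with `k` edges can carry. -/
lemma sizeParam_le {c : ℝ} {k η γ m : ℕ} (hη1 : 1 ≤ η)
    (hc0 : 1 / (η : ℝ) < c) (hc1 : c ≤ 1) : (sizeParam c k η γ m : ℝ) ≤ k := by
  have hη0 : (0 : ℝ) < η := by exact_mod_cast hη1
  have hx1 : 1 < c * η := (div_lt_iff₀ hη0).1 hc0
  have hxη : c * η ≤ η := by nlinarith
  have hY : (0 : ℝ) ≤ m * (γ + 1) := by positivity
  unfold sizeParam
  have e1 : 2 * (1 - c) * (η : ℝ) = 2 * (η - c * η) := by ring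
  rw [e1, Nat.cast_mul, Nat.cast_choose_two]
  set x := c * (η : ℝ)
  have hxa : x ≤ (⌈x⌉₊ : ℝ) := Nat.le_ceil x
  have hax : (⌈x⌉₊ : ℝ) < x + 1 := Nat.ceil_lt_add_one (by linarith)
  have haη : (⌈x⌉₊ : ℝ) ≤ η := by exact_mod_cast Nat.ceil_le.2 hxη
  set a : ℝ := (⌈x⌉₊ : ℝ)
  have hin : a / 2 ≤ x / 2 + 2 * (η - x) + m * (γ + 1) := by linarith
  have hK : 0 < x * (x / 2 + 2 * (η - x) + m * (γ + 1)) :=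
    mul_pos (by linarith) (by linarith)
  have h1 : a * (a - 1) / 2 ≤ x * (x / 2 + 2 * (η - x) + m * (γ + 1)) := by
    have := mul_le_mul (show a - 1 ≤ x by linarith) hin (by linarith) (by linarith)
    linarith
  calc _ ≤ (k : ℝ) / (x * (x / 2 + 2 * (η - x) + m * (γ + 1))) *
        (x * (x / 2 + 2 * (η - x) + m * (γ + 1))) :=
        mul_le_mul (Nat.floor_le (by positivity)) h1
          (div_nonneg (mul_nonneg (by linarith) (by linarith)) two_pos.le) (by positivity)
    _ = k := div_mul_cancel₀ _ hK.ne'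

end Ising

theorem theorem5 (θ : ℝ) (hθ : θ ∈ Set.Ioo (0 : ℝ) (1 / 2)) :
    ∃ r : ℕ → ℝ, Tendsto r atTop (𝓝 0) ∧
      ∀ (p k d η γ m n : ℕ) (c lam δ : ℝ)
        (decoder : (Fin n → Ising.Config p) → SimpleGraph (Fin p)),
        (k : ℝ) ≤ (p : ℝ) / 4 →
        1 ≤ η → η ≤ d / 2 →
        1 ≤ γ →
        m ≤ d / 2 - η →
        1 / (η : ℝ) < c → c ≤ 1 →
        0 < lam →
        Ising.errorProb lam (Ising.sparseSeparatorClass p k d η γ) decoder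
          (Ising.distortion θ c k η γ m) ≤ δ →
        max
            ((1 + Real.cosh (2 * lam) ^ ((1 - c) * (η : ℝ) - 1) *
                  ((1 + Real.tanh lam ^ (γ + 1)) / (1 - Real.tanh lam ^ (γ + 1))) ^ m) /
                (2 * lam * c * (η : ℝ)) * (Real.log 2 - Real.binEntropy θ))
            (2 * ((k : ℝ) - (Ising.distortion θ c k η γ m : ℝ)) * Real.log p /
              ((k : ℝ) * lam * Real.tanh lam)) *
            (1 - δ - r (Ising.sizeParam c k η γ m)) ≤ (n : ℝ) := by
  have hh := Ising.binEntropy_lt_log_two_of_mem hθ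
  set h := Real.log 2 - Real.binEntropy θ with hhdef
  have hl2 : 0 < Real.log 2 := Real.log_pos one_lt_two
  -- The two summands absorb the additive errors in Fano's inequality for the two families, through
  -- `N ≤ 3 M` and `4 N ≤ 4 k ≤ p`.
  -- `r 0 = 1` makes the bound vacuous when no toggle fits.
  refine ⟨fun N => if N = 0 then 1 else
    3 * Real.log 2 / h / N + 8 * Real.log 2 / Real.log (4 * N), ?_, ?_⟩
  · have h1 : Tendsto (fun N : ℕ => 3 * Real.log 2 / h / (N : ℝ)) atTop (𝓝 0) :=
      tendsto_const_div_atTop_nhds_zero_nat _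
    have h2 : Tendsto (fun N : ℕ => 8 * Real.log 2 / Real.log (4 * (N : ℝ))) atTop (𝓝 0) :=
      Tendsto.const_div_atTop (Real.tendsto_log_atTop.comp
        (tendsto_natCast_atTop_atTop.const_mul_atTop (by norm_num : (0 : ℝ) < 4))) _
    have h3 := h1.add h2
    rw [add_zero] at h3
    refine h3.congr' ?_
    filter_upwards [eventually_ne_atTop 0] with N hN
    rw [if_neg hN]
  intro p k d η γ m n c lam δ decoder hkp hη1 hηd hγ hm hc0 hc1 hlam herr
  have h4 : 4 * k ≤ p := by
    have : (4 : ℝ) * k ≤ p := by linarith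
    exact_mod_cast this
  have hη0 : (0 : ℝ) < η := by exact_mod_cast hη1
  have hx1 : 1 < c * η := (div_lt_iff₀ hη0).1 hc0
  have hxη : c * η ≤ η := by nlinarith
  have hδ : 0 ≤ δ := (Ising.errorProb_nonneg _ _ _ _).trans herr
  have ht0 := Ising.tanh_pos hlam
  have ht1 := Real.tanh_lt_one lam
  set t := Real.tanh lam with ht
  have htg : t ^ (γ + 1) < 1 := pow_lt_one₀ ht0.le ht1 (by omega)
  set P : ℝ := ((1 + t ^ (γ + 1)) / (1 - t ^ (γ + 1))) ^ m with hP
  have hP0 : 0 ≤ P := pow_nonneg (div_nonneg (by positivity) (by linarith)) m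
  set R : ℝ := Real.cosh (2 * lam) ^ ((1 - c) * (η : ℝ) - 1) * P with hR
  have hcosh : 1 ≤ Real.cosh (2 * lam) := Real.one_le_cosh _
  have hR0 : 0 ≤ R := mul_nonneg (Real.rpow_nonneg (by linarith) _) hP0
  have hden : 2 * lam * c * (η : ℝ) = 2 * lam * (c * η) := by ring
  rw [hden]
  set x := c * (η : ℝ) with hx
  have hx0 : 0 < 2 * lam * x := mul_pos (by linarith) (by linarith)
  have hfirst : 0 ≤ (1 + R) / (2 * lam * x) * h :=
    mul_nonneg (div_nonneg (by linarith) hx0.le) hh.le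
  set N := Ising.sizeParam c k η γ m with hN
  set q := Ising.distortion θ c k η γ m with hq
  set s : ℝ := 1 - δ - (if N = 0 then 1 else
    3 * Real.log 2 / h / N + 8 * Real.log 2 / Real.log (4 * N)) with hs
  show max _ _ * s ≤ (n : ℝ)
  rcases le_or_gt s 0 with hs0 | hs0
  · exact (mul_nonpos_of_nonneg_of_nonpos (hfirst.trans (le_max_left _ _)) hs0).trans
      (Nat.cast_nonneg n)
  have hN0 : N ≠ 0 := by
    intro h0
    rw [hs, if_pos h0] at hs0
    linarith
  rw [if_neg hN0] at hs
  have hN1 : 1 ≤ N := Nat.one_le_iff_ne_zero.2 hN0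
  have hNR : (1 : ℝ) ≤ N := by exact_mod_cast hN1
  have hNk : (N : ℝ) ≤ k := Ising.sizeParam_le hη1 hc0 hc1
  have hlog4N : 0 < Real.log (4 * N) := Real.log_pos (by linarith)
  have hr1 : 0 ≤ 3 * Real.log 2 / h / N := by positivity
  have hr2 : 0 ≤ 8 * Real.log 2 / Real.log (4 * N) := by positivity
  rw [max_mul_of_nonneg _ _ hs0.le]
  refine max_le ?_ ?_
  · obtain ⟨M, hNM, hM⟩ := Ising.exists_toggle_family hθ hh.le h4 hη1 hηd hγ hm hc0 hc1 hlam herr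
      hN1
    rw [Ising.one_add_tanh_sq_div, ← ht, ← hP, ← hx, ← hhdef] at hM
    set R' : ℝ := Real.cosh (2 * lam) ^ (η - ⌈x⌉₊) * P with hR'
    have hRR : R ≤ R' := by
      refine mul_le_mul_of_nonneg_right ?_ hP0
      rw [← Real.rpow_natCast]
      refine Real.rpow_le_rpow_of_exponent_le hcosh ?_
      rw [Nat.cast_sub (Nat.ceil_le.2 hxη)]
      have := Nat.ceil_lt_add_one (show 0 ≤ x by linarith)
      have e : (1 - c) * (η : ℝ) = η - x := by rw [hx]; ring
      linarith
    have hM0 : (0 : ℝ) < M := by linarith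
    have h1 : Real.log 2 ≤ M * h * (3 * Real.log 2 / h / N) := by
      have : M * h * (3 * Real.log 2 / h / N) = Real.log 2 * (3 * M / N) := by
        field_simp
      rw [this]
      refine le_mul_of_one_le_right hl2.le ?_
      rw [le_div_iff₀ (by linarith)]
      linarith
    have h2 : M * (h * s) ≤ M * (n * (2 * lam * (x / (1 + R')))) := by
      have h3 : M * h * s ≤ M * h * (1 - δ - 3 * Real.log 2 / h / N) :=
        mul_le_mul_of_nonneg_left (by linarith) (by positivity)
      generalize 3 * Real.log 2 / h / (N : ℝ) = u at h1 h3
      linarith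
    have h4 := le_of_mul_le_mul_left h2 hM0
    have h5 : n * (2 * lam * (x / (1 + R'))) = n * (2 * lam * x) / (1 + R') := by ring
    rw [h5, le_div_iff₀ (by linarith)] at h4
    have h6 : (1 + R) / (2 * lam * x) * h * s = h * s * (1 + R) / (2 * lam * x) := by ring
    rw [h6, div_le_iff₀ hx0]
    exact (mul_le_mul_of_nonneg_left (by linarith) (mul_nonneg hh.le hs0.le)).trans h4
  · have hk1 : 1 ≤ k := by
      have : (1 : ℝ) ≤ k := hNR.trans hNk
      exact_mod_cast this
    have hkR : (1 : ℝ) ≤ k := by exact_mod_cast hk1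
    have hqk : (q : ℝ) ≤ k / 2 := Ising.distortion_le hθ hη1 hc0 hc1
    have hqk' : q ≤ k := by
      have : (q : ℝ) ≤ k := by linarith
      exact_mod_cast this
    have hlogp : Real.log (4 * N) ≤ Real.log p :=
      Real.log_le_log (by linarith) (by linarith)
    have hlp0 : 0 < Real.log p := hlog4N.trans_le hlogp
    set r2 : ℝ := 8 * Real.log 2 / Real.log (4 * N) with hr2def
    have hr2p : 8 * Real.log 2 ≤ r2 * Real.log p := by
      have : 8 * Real.log 2 / Real.log p ≤ r2 :=
        div_le_div_of_nonneg_left (by positivity) hlog4N hlogp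
      rwa [div_le_iff₀ hlp0] at this
    have hcost : 4 * k * Real.log 2 ≤ (k - q) * Real.log p * r2 := by
      have h1 : (k : ℝ) / 2 ≤ k - q := by linarith
      have h2 := mul_le_mul h1 hr2p (by positivity) (by linarith)
      linarith
    have hsr : s ≤ 1 - δ - r2 := by linarith
    have hkq : 0 ≤ ((k : ℝ) - q) * Real.log p := mul_nonneg (by linarith) hlp0.le
    have hkl : 0 ≤ (k : ℝ) * Real.log 2 := by positivity
    have hΛ : 0 ≤ ((k : ℝ) - q) * Real.log p - 3 * k * Real.log 2 := by
      have : r2 ≤ 1 := by linarith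
      have := mul_le_mul_of_nonneg_left this hkq
      linarith
    have key := Ising.matching_bound h4 hk1 hqk' (by omega) hη1 hlam herr hΛ
    rw [← ht] at key
    rw [div_mul_eq_mul_div, div_le_iff₀ (by positivity)]
    have h1 := mul_le_mul_of_nonneg_left hsr hkq
    have h2 : Real.log 2 ≤ k * Real.log 2 := le_mul_of_one_le_left hl2.le hkR
    have h3 := mul_nonneg hδ hkl
    linarith
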